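/- Let $\lambda\in\mathbb R\setminus\mathbb Q$, let $\mathbb T^2=S^1\times S^1$, let $\iota_\lambda:\mathbb R\to\mathbb T^2$, $t\mapsto(e^{2\pi i t},e^{2\pi i\lambda t})$, and let $\pi:\mathbb T^2\to G=\mathbb T^2/\iota_\lambda(\mathbb R)$ be the quotient homomorphism ($G\cong\mathbb R/(\mathbb Z+\lambda\mathbb Z)$ is the group $G(M,\omega)$ of $M=S^2\times S^2$ with $\omega=p_1^*V+\lambda p_2^*V$). Give $G$ the diffeology $D(G)$ generated by the restrictions of $\pi$ to open subsets of $\mathbb T^2$: a map $\chi:\mathcal O_\chi\to G$ on an open subset of some $\mathbb R^k$ is a plot if it is locally of the form $\pi\circ h$ with $h$ a smooth map to $\mathbb T^2$. Let $\mathbb T^2\rtimes_\lambda\mathbb R$ be the action groupoid, with $s(g,t)=g$ and $r(g,t)=g\,\iota_\lambda(t)$. For a submersion $\phi$, let $\phi_!$ denote integration of compactly supported smooth $1$-densities along the fibres. Let $(\mathcal O_i)_{i\in I}$ be an open cover of $\mathbb T^2$. Let $$C_c^\infty(G)=\Big(\bigoplus_i C_c^\infty(\mathcal O_i;\Omega^1)\Big)\Big/\mathcal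 I ,$$ where $\mathcal I$ is spanned by the elements $p_!(f)$ such that $p:W\to\coprod_i\mathcal O_i$ and $q:W\to\mathcal O_\chi$ are submersions, $\chi:\mathcal O_\chi\to G$ is a plot with $\pi\circ p=\chi\circ q$, and $f\in C_c^\infty(W;\Omega^1)$ satisfies $q_!(f)=0$ (here $W$ is a finite disjoint union of open subsets of Euclidean spaces). Put $U_{ij}=s^{-1}(\mathcal O_i)\cap r^{-1}(\mathcal O_j)$ and let $$C_c^\infty(\mathbb T^2\rtimes_\lambda\mathbb R)=\Big(\bigoplus_{i,j}C_c^\infty(U_{ij};\Omega^1)\Big)\Big/\mathcal J,$$ where $\mathcal J$ is defined in the same way from bisubmersions, i.e. submersions $\varphi$ from open subsets of Euclidean spaces to $\mathbb T^2\rtimes_\lambda\mathbb R$, and submersions commuting with the maps to $\mathbb T^2\rtimes_\lambda\mathbb R$. The class of a compactly supported smooth density on $\mathbb T^2$ (respectively on $\mathbb T^2\times\mathbb R$) is the class of any element of the direct sum whose components add up to it. Then the following hold. (1) There is exactly one $*$-algebra structure on $C_c^\infty(G)$ for which, for all $a,b$ in the direct sum, with $a,b$ also denoting the densities on $\mathbb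 T^2$ to which their components add up, $[a]*[b]$ is the class of $m_!(a\otimes b)$ and $[a]^*$ is the class of $\overline a\circ\mathrm{inv}^{-1}$, where $m$ and $\mathrm{inv}$ are the multiplication and the inversion of the group $\mathbb T^2$. (2) There is exactly one $*$-algebra structure on $C_c^\infty(\mathbb T^2\rtimes_\lambda\mathbb R)$ given by the same formulas for the multiplication and the inversion of the product group $\mathbb T^2\times\mathbb R$. (3) There is exactly one linear map $\Phi:C_c^\infty(\mathbb T^2\rtimes_\lambda\mathbb R)\to C_c^\infty(G)$ that sends the class of $f\in C_c^\infty(U_{ij};\Omega^1)$ to the class of $r_!(f)\in C_c^\infty(\mathcal O_j;\Omega^1)$, for all $i,j$. It is surjective. (4) $\Phi$ is a $*$-homomorphism for these structures: $\Phi(x^*)=\Phi(x)^*$ and $\Phi(x*y)=\Phi(x)*\Phi(y)$ for all $x,y\in C_c^\infty(\mathbb T^2\rtimes_\lambda\mathbb R)$. -/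

import Mathlib

open Set Filter Topology MeasureTheory
open scoped ContDiff DirectSum

noncomputable section

namespace IrrationalTorus

/-! ### The torus, the irrational line, the quotient group and the action groupoid -/

/-- The Lie group `𝕋² = S¹ × S¹`, written additively as `ℝ/ℤ × ℝ/ℤ`: the pair `(x, y)` of classes
stands for `(exp (2πi x), exp (2πi y))`. Its `volume` is the Haar probability measure. -/
abbrev Torus : Type := UnitAddCircle × UnitAddCircle

/-- The universal covering homomorphism `ℝ² → 𝕋²`. -/
def torusMk (v : ℝ × ℝ) : Torus := ((v.1 : UnitAddCircle), (v.2 : UnitAddCircle))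

/-- The homomorphism `t ↦ (exp (2πi t), exp (2πi lam t))` from `ℝ` to `𝕋²`. -/
def line (lam : ℝ) : ℝ →+ Torus where
  toFun t := torusMk (t, lam * t)
  map_zero' := by simp [torusMk]
  map_add' s t := by simp [torusMk, mul_add]

/-- The group `G = 𝕋² / line(ℝ)`. -/
abbrev LeafGroup (lam : ℝ) : Type := Torus ⧸ (line lam).range

/-- The quotient homomorphism `π : 𝕋² → G`. -/
def proj (lam : ℝ) : Torus →+ LeafGroup lam := QuotientAddGroup.mk' (line lam).range

/-- The space of arrows of the action groupoid `𝕋² ⋊ ℝ`. As an additive group it carries the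
product group structure. Its `volume` is Haar measure times Lebesgue measure. -/
abbrev Groupoid : Type := Torus × ℝ

/-- The universal covering homomorphism `ℝ² × ℝ → 𝕋² × ℝ`. -/
def groupoidMk (v : (ℝ × ℝ) × ℝ) : Groupoid := (torusMk v.1, v.2)

/-- The source map `(g, t) ↦ g` of the action groupoid. -/
def source (x : Groupoid) : Torus := x.1

/-- The range map `(g, t) ↦ g ⬝ t` of the action groupoid. -/
def range (lam : ℝ) (x : Groupoid) : Torus := x.1 + line lam x.2

/-! ### Smooth maps, densities and integration along the fibres

The manifolds `ℝ^k`, `𝕋²` and `𝕋² × ℝ` are described by a covering `e : F → Y` from a vector space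
(`id`, `torusMk`, `groupoidMk`), which is a local diffeomorphism. -/

/-- `p : U → Y` is a smooth submersion on `U ⊆ ℝⁿ`: near every point of `U` it has a smooth
lift `P` through the covering `e`, and the differential of `P` at that point is onto. -/
def IsSubmersionOn {F Y : Type} [NormedAddCommGroup F] [NormedSpace ℝ F] (e : F → Y) {n : ℕ}
    (U : Set (Fin n → ℝ)) (p : (Fin n → ℝ) → Y) : Prop :=
  ∀ x ∈ U, ∃ P : (Fin n → ℝ) → F,
    (∀ᶠ y in 𝓝 x, ContDiffAt ℝ ∞ P y ∧ p y = e (P y)) ∧ Function.Surjective (fderiv ℝ P x)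

/-- The smooth compactly supported densities on an open subset `S` of `Y`. The density bundle is
trivialised by the invariant (Lebesgue or Haar) density, and sections are extended by zero. -/
def densities {F Y : Type} [NormedAddCommGroup F] [NormedSpace ℝ F] [TopologicalSpace Y]
    (e : F → Y) (S : Set Y) : Submodule ℂ (Y → ℂ) where
  carrier := {f | ContDiff ℝ ∞ (f ∘ e) ∧ HasCompactSupport f ∧ tsupport f ⊆ S}
  zero_mem' := by
    refine ⟨?_, HasCompactSupport.zero, ?_⟩
    · exact contDiff_const (c := (0 : ℂ))
    · simp [tsupport]
  add_mem' := by
    rintro f g ⟨hf, hf', hf''⟩ ⟨hg, hg', hg''⟩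
    exact ⟨hf.add hg, hf'.add hg', (tsupport_add f g).trans (union_subset hf'' hg'')⟩
  smul_mem' := by
    rintro c f ⟨hf, hf', hf''⟩
    refine ⟨contDiff_const.smul hf, hf'.smul_left (f := fun _ => c), ?_⟩
    exact (closure_mono (Function.support_const_smul_subset c f)).trans hf''

/-- The complex vector space `C_c^∞(S; Ω¹ S)`. -/
def Dens {F Y : Type} [NormedAddCommGroup F] [NormedSpace ℝ F] [TopologicalSpace Y]
    (e : F → Y) (S : Set Y) : Type := densities e S

section

variable {F Y : Type} [NormedAddCommGroup F] [NormedSpace ℝ F] [TopologicalSpace Y]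

instance (e : F → Y) (S : Set Y) : AddCommGroup (Dens e S) :=
  inferInstanceAs (AddCommGroup (densities e S))

instance (e : F → Y) (S : Set Y) : Module ℂ (Dens e S) :=
  inferInstanceAs (Module ℂ (densities e S))

/-- The coefficient of a density on `S`, as a function on `Y`. -/
def Dens.coeff {e : F → Y} {S : Set Y} : Dens e S →ₗ[ℂ] (Y → ℂ) := (densities e S).subtype

end

/-- `g = φ_! f`: the density `g` is the integral of the density `f` along the fibres of `φ`, that
is, its push-forward, expressed by Fubini's formula `∫ f ⬝ (u ∘ φ) = ∫ g ⬝ u` for all continuous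
test functions `u`. It determines the continuous density `g`. -/
def IsFiberIntegral {X Y : Type} [MeasureSpace X] [MeasureSpace Y] [TopologicalSpace Y]
    (φ : X → Y) (f : X → ℂ) (g : Y → ℂ) : Prop :=
  ∀ u : C(Y, ℂ), ∫ x, f x * u (φ x) = ∫ y, g y * u y

/-! ### The diffeology of `G` and the bisubmersions of the groupoid -/

/-- `χ : V → G` with `V ⊆ ℝ^k` open is a plot of the diffeology of `G` generated by the
restrictions of `π` to the open subsets of `𝕋²`: locally `χ = π ∘ h` with `h` a smooth map to `𝕋²`,
given here by a lift `P` to `ℝ²`. Locally constant maps are the case of constant `P`. -/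
def IsPlot (lam : ℝ) {k : ℕ} (V : Set (Fin k → ℝ)) (χ : (Fin k → ℝ) → LeafGroup lam) : Prop :=
  IsOpen V ∧ ∀ x ∈ V, ∃ P : (Fin k → ℝ) → ℝ × ℝ,
    ∀ᶠ y in 𝓝 x, ContDiffAt ℝ ∞ P y ∧ χ y = proj lam (torusMk (P y))

/-- `φ : V → 𝕋² ⋊ ℝ` with `V ⊆ ℝ^k` open is a bisubmersion for the full Lie algebroid of the
groupoid: `φ` is a submersion. All of these are adapted to the path-holonomy atlas. -/
def IsBisubmersion {k : ℕ} (V : Set (Fin k → ℝ)) (φ : (Fin k → ℝ) → Groupoid) : Prop :=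
  IsOpen V ∧ IsSubmersionOn groupoidMk V φ

/-! ### The quotient spaces -/

section Quotients

variable {ι F Y Z : Type} [DecidableEq ι] [NormedAddCommGroup F] [NormedSpace ℝ F]
  [TopologicalSpace Y] [MeasureSpace Y]

/-- The subspace of `⨁ i, C_c^∞(O i; Ω¹)` spanned by the elements `p_!(f)`, where `f` is a density
with `q_!(f) = 0` and `p : W → ∐ i, O i` and `q : W → V` are submersions with `ρ ∘ p = χ ∘ q` for an
admissible `χ : V → Z`. Here `W` is a finite disjoint union of open sets `W a ⊆ ℝ^(n a)`,
and `p`, `q`, `f` are given by their restrictions `p a : W a → O (idx a)`, `q a : W a → V`, `f a`. -/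
def relations (e : F → Y) (ρ : Y → Z)
    (adm : ∀ k : ℕ, Set (Fin k → ℝ) → ((Fin k → ℝ) → Z) → Prop) (O : ι → Set Y) :
    Submodule ℂ (⨁ i, Dens e (O i)) :=
  Submodule.span ℂ {x |
    ∃ (k : ℕ) (V : Set (Fin k → ℝ)) (χ : (Fin k → ℝ) → Z)
      (N : ℕ) (n : Fin N → ℕ) (W : ∀ a, Set (Fin (n a) → ℝ)) (idx : Fin N → ι)
      (p : ∀ a, (Fin (n a) → ℝ) → Y) (q : ∀ a, (Fin (n a) → ℝ) → (Fin k → ℝ))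
      (f : ∀ a, Dens (id : (Fin (n a) → ℝ) → (Fin (n a) → ℝ)) (W a))
      (g : ∀ a, Dens e (O (idx a))),
      adm k V χ ∧
      (∀ a, IsOpen (W a) ∧
        IsSubmersionOn e (W a) (p a) ∧ MapsTo (p a) (W a) (O (idx a)) ∧
        IsSubmersionOn id (W a) (q a) ∧ MapsTo (q a) (W a) V ∧
        ∀ y ∈ W a, ρ (p a y) = χ (q a y)) ∧
      (∀ u : C(Fin k → ℝ, ℂ), ∑ a, ∫ y, (f a).coeff y * u (q a y) = 0) ∧
      (∀ a, IsFiberIntegral (p a) (f a).coeff (g a).coeff) ∧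
      x = ∑ a, DirectSum.lof ℂ ι (fun i => Dens e (O i)) (idx a) (g a)}

/-- The density `∑ i, f i` on `Y` glued from `f ∈ ⨁ i, C_c^∞(O i; Ω¹)`. -/
def total (e : F → Y) (O : ι → Set Y) : (⨁ i, Dens e (O i)) →ₗ[ℂ] (Y → ℂ) :=
  DirectSum.toModule ℂ ι (Y → ℂ) (fun _ => Dens.coeff)

end Quotients

section Spaces

variable {ι : Type} [DecidableEq ι] (lam : ℝ) (O : ι → Set Torus)

/-- The space `C_c^∞(G)`, built from an open cover `O` of `𝕋²`. -/
abbrev CcG : Type :=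
  (⨁ i, Dens torusMk (O i)) ⧸
    relations torusMk (proj lam) (fun _ V χ => IsPlot lam V χ) O

/-- The class in `C_c^∞(G)`. -/
def mkG : (⨁ i, Dens torusMk (O i)) →ₗ[ℂ] CcG lam O := Submodule.mkQ _

/-- The open sets `s⁻¹(O i) ∩ r⁻¹(O j)` of the groupoid; with their inclusions they are minimal
bisubmersions. -/
def box (ij : ι × ι) : Set Groupoid := {x | source x ∈ O ij.1 ∧ range lam x ∈ O ij.2}

/-- The space `C_c^∞(𝕋² ⋊ ℝ)` of the atlas of bisubmersions. A morphism of bisubmersions from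
`φ : W → 𝕋² ⋊ ℝ` to a `box` with its inclusion is `φ` itself. -/
abbrev CcGroupoid : Type :=
  (⨁ ij, Dens groupoidMk (box lam O ij)) ⧸
    relations groupoidMk (id : Groupoid → Groupoid) (fun _ V φ => IsBisubmersion V φ) (box lam O)

/-- The class in `C_c^∞(𝕋² ⋊ ℝ)`. -/
def mkGroupoid : (⨁ ij, Dens groupoidMk (box lam O ij)) →ₗ[ℂ] CcGroupoid lam O :=
  Submodule.mkQ _

end Spaces

/-! ### `*`-algebra structures and the map `Φ` -/

/-- A `*`-algebra structure (associative, not necessarily unital) on a complex vector space. -/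
@[ext] structure StarAlg (A : Type) [AddCommGroup A] [Module ℂ A] where
  mul : A →ₗ[ℂ] A →ₗ[ℂ] A
  star : A →ₛₗ[starRingEnd ℂ] A
  mul_assoc : ∀ x y z, mul (mul x y) z = mul x (mul y z)
  star_star : ∀ x, star (star x) = x
  star_mul : ∀ x y, star (mul x y) = mul (star y) (star x)

/-- `c = m_!(a ⊗ b)`, where `m` is the product map of the group `Y`. -/
def IsConvolution {Y : Type} [AddGroup Y] [MeasureSpace Y] [TopologicalSpace Y]
    (a b c : Y → ℂ) : Prop :=
  IsFiberIntegral (fun z : Y × Y => z.1 + z.2) (fun z : Y × Y => a z.1 * b z.2) c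

/-- `a^* = conj a ∘ inv⁻¹`, where `inv` is the inversion of the group `Y`. -/
def involution {Y : Type} [AddGroup Y] (a : Y → ℂ) : Y → ℂ := fun y => starRingEnd ℂ (a (-y))

section Structures

variable {ι : Type} [DecidableEq ι] (lam : ℝ) (O : ι → Set Torus)

/-- `S` is the `*`-algebra structure on `C_c^∞(G)` coming from the group structure of `𝕋²`:
`[a] * [b]` is the class of `m_!(a ⊗ b)` and `[a]^*` is the class of `a^*`. The class of a density
on `𝕋²` is the class of any `c ∈ ⨁ i, C_c^∞(O i; Ω¹)` that adds up to it. -/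
def IsTorusStructure (S : StarAlg (CcG lam O)) : Prop :=
  (∀ a b c, IsConvolution (total torusMk O a) (total torusMk O b) (total torusMk O c) →
    S.mul (mkG lam O a) (mkG lam O b) = mkG lam O c) ∧
  ∀ a c, total torusMk O c = involution (total torusMk O a) →
    S.star (mkG lam O a) = mkG lam O c

/-- `T` is the `*`-algebra structure on `C_c^∞(𝕋² ⋊ ℝ)` coming from the product group structure of
`𝕋² × ℝ`. -/
def IsProductGroupStructure (T : StarAlg (CcGroupoid lam O)) : Prop :=
  (∀ a b c, IsConvolution (total groupoidMk (box lam O) a) (total groupoidMk (box lam O) b)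
      (total groupoidMk (box lam O) c) →
    T.mul (mkGroupoid lam O a) (mkGroupoid lam O b) = mkGroupoid lam O c) ∧
  ∀ a c, total groupoidMk (box lam O) c = involution (total groupoidMk (box lam O) a) →
    T.star (mkGroupoid lam O a) = mkGroupoid lam O c

/-- `Φ` sends the class of `f ∈ C_c^∞(s⁻¹(O i) ∩ r⁻¹(O j); Ω¹)` to the class of
`r_!(f) ∈ C_c^∞(O j; Ω¹)`. -/
def IsPhi (Φ : CcGroupoid lam O →ₗ[ℂ] CcG lam O) : Prop :=
  ∀ (ij : ι × ι) (f : Dens groupoidMk (box lam O ij)) (g : Dens torusMk (O ij.2)),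
    IsFiberIntegral (range lam) f.coeff g.coeff →
      Φ (mkGroupoid lam O 
        (DirectSum.lof ℂ (ι × ι) (fun ij => Dens groupoidMk (box lam O ij)) ij f)) =
         mkG lam O (DirectSum.lof ℂ ι (fun i => Dens torusMk (O i)) ij.2 g)

end Structures

end IrrationalTorus

end

/-! Let `Y` be `𝕋²` or `𝕋² × ℝ` and `D(Y)` the space of compactly supported smooth densities on `Y`.
Both quotient spaces are quotients of `D(Y)`: adding up components is onto `D(Y)` by a partition of
unity (`IsUnfolding.exists_total_eq`), and an element whose components add up to zero is a relation
(`IsUnfolding.mem_relations_of_total_eq_zero`). On `D(Y)` convolution and involution form a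
`*`-algebra, so (1) and (2) reduce to showing that the relations are stable under the involution and
under convolution with any density. `StarAlg.exists_descent` then produces the structure.

For the groupoid, `p = χ ∘ q` in every relation, hence `p_! f` is determined by `q_! f = 0`, and the
relations are exactly the elements of total zero (`total_eq_zero_of_mem_groupoid_relations`). The
quotient is the convolution algebra `D(𝕋² × ℝ)` itself.

On the torus a relation need not have total zero, and the group law of `G` enters. The involution
turns the data `(p, q, χ, f)` into `(-p, q, -χ, conj f)`. Convolution with `b` adds a variable `v ∈
ℝ²`: `p` becomes `v + p`, `q` becomes `(v, q)`, the plot becomes `π(v) + χ`, and `f` becomes `β ⊗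
f`, where `β` is a compactly supported lift of `b`; integrating along `q` first still gives zero.
The new push-forwards no longer lie in members of the cover, which a partition of unity pulled back
along `p` repairs (`IsUnfolding.mem_relations_of_total_eq_sum`).

The map `Φ` is induced by `r_!`. It is well defined because groupoid relations have total zero. As
`r` is a group homomorphism, `r_!` respects convolution and inversion (`pushRange_conv`,
`pushRange_involution`), and it is onto because a density can be spread along the fibres of `r` with
total weight one. Uniqueness holds because the prescribed values cover all classes, or generators of
them. -/

set_option linter.unusedSectionVars false

noncomputable section

namespace IrrationalTorus

/-! ### Coverings with a smooth weight that unfolds integrals -/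

section Unfolding

/-- `e : F → Y` is an open quotient homomorphism and `θ` is a smooth weight whose integrals along
the fibres of `e` are `1`; moreover `Y` has bump functions that are smooth through `e`. -/
structure IsUnfolding {F Y : Type} [NormedAddCommGroup F] [NormedSpace ℝ F] [MeasureSpace F]
    [AddCommGroup Y] [TopologicalSpace Y] [MeasureSpace Y] (e : F → Y) (θ : F → ℝ) : Prop where
  map_add : ∀ v w, e (v + w) = e v + e w
  isOpenQuotientMap : IsOpenQuotientMap e
  contDiff : ContDiff ℝ ∞ θ
  nonneg : ∀ v, 0 ≤ θ v
  exists_isCompact : ∀ K : Set Y, IsCompact K →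
    ∃ K' : Set F, IsCompact K' ∧ ∀ v, θ v ≠ 0 → e v ∈ K → v ∈ K'
  map_eq : (volume.withDensity fun v => ENNReal.ofReal (θ v)).map e = volume
  exists_bump : ∀ y, ∀ U ∈ 𝓝 y, ∃ b : Y → ℝ, ContDiff ℝ ∞ (b ∘ e) ∧ HasCompactSupport b ∧
    tsupport b ⊆ U ∧ (∀ z, 0 ≤ b z) ∧ 0 < b y

theorem IsUnfolding.prodMap {F₁ Y₁ F₂ Y₂ : Type}
    [NormedAddCommGroup F₁] [NormedSpace ℝ F₁] [MeasureSpace F₁] [BorelSpace F₁]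
    [AddCommGroup Y₁] [TopologicalSpace Y₁] [MeasureSpace Y₁] [BorelSpace Y₁]
    [NormedAddCommGroup F₂] [NormedSpace ℝ F₂] [MeasureSpace F₂] [BorelSpace F₂]
    [AddCommGroup Y₂] [TopologicalSpace Y₂] [MeasureSpace Y₂] [BorelSpace Y₂]
    [SigmaFinite (volume : Measure F₁)] [SigmaFinite (volume : Measure F₂)]
    {e₁ : F₁ → Y₁} {θ₁ : F₁ → ℝ} {e₂ : F₂ → Y₂} {θ₂ : F₂ → ℝ}
    (h₁ : IsUnfolding e₁ θ₁) (h₂ : IsUnfolding e₂ θ₂) :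
    IsUnfolding (Prod.map e₁ e₂) (fun v => θ₁ v.1 * θ₂ v.2) where
  map_add v w := by simp [Prod.map, h₁.map_add, h₂.map_add]
  isOpenQuotientMap := h₁.isOpenQuotientMap.prodMap h₂.isOpenQuotientMap
  contDiff := (h₁.contDiff.comp contDiff_fst).mul (h₂.contDiff.comp contDiff_snd)
  nonneg v := mul_nonneg (h₁.nonneg _) (h₂.nonneg _)
  exists_isCompact K hK := by
    obtain ⟨K₁, hK₁, h₁'⟩ := h₁.exists_isCompact (Prod.fst '' K) (hK.image continuous_fst)
    obtain ⟨K₂, hK₂, h₂'⟩ := h₂.exists_isCompact (Prod.snd '' K) (hK.image continuous_snd)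
    refine ⟨K₁ ×ˢ K₂, hK₁.prod hK₂, fun v hv hvK => ⟨?_, ?_⟩⟩
    · exact h₁' _ (left_ne_zero_of_mul hv) ⟨_, hvK, rfl⟩
    · exact h₂' _ (right_ne_zero_of_mul hv) ⟨_, hvK, rfl⟩
  map_eq := by
    have m₁ : Measurable fun v => ENNReal.ofReal (θ₁ v) :=
      h₁.contDiff.continuous.measurable.ennreal_ofReal
    have m₂ : Measurable fun v => ENNReal.ofReal (θ₂ v) :=
      h₂.contDiff.continuous.measurable.ennreal_ofReal
    have hmul : (fun v : F₁ × F₂ => ENNReal.ofReal (θ₁ v.1 * θ₂ v.2)) =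
        fun v => ENNReal.ofReal (θ₁ v.1) * ENNReal.ofReal (θ₂ v.2) :=
      funext fun v => ENNReal.ofReal_mul (h₁.nonneg _)
    rw [hmul, Measure.volume_eq_prod, ← prod_withDensity m₁ m₂,
      ← Measure.map_prod_map _ _ h₁.isOpenQuotientMap.continuous.measurable
        h₂.isOpenQuotientMap.continuous.measurable, h₁.map_eq, h₂.map_eq,
      Measure.volume_eq_prod]
  exists_bump := by
    rintro ⟨y₁, y₂⟩ U hU
    obtain ⟨U₁, hU₁, U₂, hU₂, hU'⟩ := mem_nhds_prod_iff.1 hU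
    obtain ⟨b₁, hb₁, hc₁, hs₁, hn₁, hp₁⟩ := h₁.exists_bump y₁ U₁ hU₁
    obtain ⟨b₂, hb₂, hc₂, hs₂, hn₂, hp₂⟩ := h₂.exists_bump y₂ U₂ hU₂
    have hsub : tsupport (fun y : Y₁ × Y₂ => b₁ y.1 * b₂ y.2) ⊆ tsupport b₁ ×ˢ tsupport b₂ := by
      refine closure_minimal (fun y hy => ?_)
        ((isClosed_tsupport b₁).prod (isClosed_tsupport b₂))
      exact ⟨subset_tsupport _ (left_ne_zero_of_mul hy), subset_tsupport _ (right_ne_zero_of_mul hy)⟩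
    refine ⟨fun y => b₁ y.1 * b₂ y.2, ?_, ?_, ?_, fun z => mul_nonneg (hn₁ _) (hn₂ _),
      mul_pos hp₁ hp₂⟩
    · exact (hb₁.comp contDiff_fst).mul (hb₂.comp contDiff_snd)
    · exact (IsCompact.prod hc₁ hc₂).of_isClosed_subset (isClosed_tsupport _) hsub
    · exact hsub.trans ((prod_mono hs₁ hs₂).trans hU')

theorem isUnfolding_id : IsUnfolding (id : ℝ → ℝ) (fun _ => 1) where
  map_add _ _ := rfl
  isOpenQuotientMap := IsOpenQuotientMap.id
  contDiff := contDiff_const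
  nonneg _ := zero_le_one
  exists_isCompact K hK := ⟨K, hK, fun _ _ h => h⟩
  map_eq := by simp
  exists_bump y U hU := by
    obtain ⟨b, hs, hc, hb, hr, hy⟩ := exists_contDiff_tsupport_subset (n := ⊤) hU
    exact ⟨b, hb, hc, hs, fun z => (hr ⟨z, rfl⟩).1, by rw [hy]; exact one_pos⟩

/-- A smooth weight on `ℝ` whose integer translates add up to `1`. -/
def circleWeight (t : ℝ) : ℝ := Real.smoothTransition (t + 1) - Real.smoothTransition t

theorem circleWeight_of_nonpos {t : ℝ} (ht : t ≤ 0) :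
    circleWeight t = Real.smoothTransition (t + 1) := by
  rw [circleWeight, Real.smoothTransition.zero_of_nonpos ht, sub_zero]

theorem circleWeight_of_nonneg {t : ℝ} (ht : 0 ≤ t) :
    circleWeight t = 1 - Real.smoothTransition t := by
  rw [circleWeight, Real.smoothTransition.one_of_one_le (by linarith)]

theorem circleWeight_nonneg (t : ℝ) : 0 ≤ circleWeight t := by
  rcases le_total t 0 with ht | ht
  · rw [circleWeight_of_nonpos ht]
    exact Real.smoothTransition.nonneg _
  · rw [circleWeight_of_nonneg ht]
    exact sub_nonneg.2 (Real.smoothTransition.le_one _)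

theorem circleWeight_eq_zero {t : ℝ} (ht : t ∉ Ioc (-1 : ℝ) 1) : circleWeight t = 0 := by
  rw [mem_Ioc, not_and_or, not_lt, not_le] at ht
  rcases ht with ht | ht
  · rw [circleWeight_of_nonpos (by linarith),
      Real.smoothTransition.zero_of_nonpos (by linarith)]
  · rw [circleWeight_of_nonneg (by linarith),
      Real.smoothTransition.one_of_one_le (by linarith), sub_self]

theorem contDiff_circleWeight : ContDiff ℝ ∞ circleWeight :=
  (Real.smoothTransition.contDiff.comp (contDiff_id.add contDiff_const)).sub
    Real.smoothTransition.contDiff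

/-- The weight lives on `(-1, 1]`. Moving its half over `(-1, 0]` by `1` stacks the values `σ(t)`
and `1 - σ(t)` over the same point of `(0, 1]`, with `σ` the smooth transition, and these add up to
`1` on a fundamental domain. -/
theorem lintegral_circleWeight (f : UnitAddCircle → ENNReal) (hf : Measurable f) :
    ∫⁻ t : ℝ, ENNReal.ofReal (circleWeight t) * f t = ∫⁻ y, f y := by
  have hmk : Measurable fun t : ℝ => f t := hf.comp AddCircle.measurable_mk'
  have hσ : Measurable fun t : ℝ => ENNReal.ofReal (Real.smoothTransition t) :=
    Real.smoothTransition.continuous.measurable.ennreal_ofReal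
  have hσf : Measurable fun t : ℝ => ENNReal.ofReal (Real.smoothTransition t) * f t := hσ.mul hmk
  have h0 : ∫⁻ t : ℝ, ENNReal.ofReal (circleWeight t) * f t =
      ∫⁻ t in Ioc (-1 : ℝ) 1, ENNReal.ofReal (circleWeight t) * f t := by
    refine (setLIntegral_eq_of_support_subset ?_).symm
    intro t ht
    by_contra h
    exact ht (by simp [circleWeight_eq_zero h])
  have hsplit : Ioc (-1 : ℝ) 1 = Ioc (-1) 0 ∪ Ioc 0 1 :=
    (Ioc_union_Ioc_eq_Ioc (by norm_num) (by norm_num)).symm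
  have h1 : ∫⁻ t in Ioc (-1 : ℝ) 0, ENNReal.ofReal (circleWeight t) * f t =
      ∫⁻ t in Ioc (0 : ℝ) 1, ENNReal.ofReal (Real.smoothTransition t) * f t := by
    have hmp : MeasurePreserving (fun t : ℝ => t + 1) (volume.restrict (Ioc (-1 : ℝ) 0))
        (volume.restrict (Ioc (0 : ℝ) 1)) := by
      have := (measurePreserving_add_right (volume : Measure ℝ) 1).restrict_preimage
        (measurableSet_Ioc (a := (0 : ℝ)) (b := 1))
      simpa using this
    rw [← hmp.lintegral_comp hσf]
    refine setLIntegral_congr_fun measurableSet_Ioc fun t ht => ?_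
    rw [circleWeight_of_nonpos ht.2]
    congr 2
    simp
  rw [h0, hsplit, lintegral_union measurableSet_Ioc (Ioc_disjoint_Ioc_of_le le_rfl), h1,
    ← lintegral_add_left hσf, ← UnitAddCircle.lintegral_preimage 0 f, zero_add]
  refine setLIntegral_congr_fun measurableSet_Ioc fun t ht => ?_
  rw [circleWeight_of_nonneg ht.1.le, ← add_mul,
    ← ENNReal.ofReal_add (Real.smoothTransition.nonneg _)
      (sub_nonneg.2 (Real.smoothTransition.le_one _))]
  simp

/-- The function `m z = 1 - Re exp(2πi(z - y))` is smooth, nonnegative and zero only at `y`. By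
compactness some sublevel set `m ≤ δ` lies in `U`, and `expNegInvGlue (δ - m)` is supported there.
-/
theorem UnitAddCircle.exists_bump (y : UnitAddCircle) (U : Set UnitAddCircle) (hU : U ∈ 𝓝 y) :
    ∃ b : UnitAddCircle → ℝ, ContDiff ℝ ∞ (b ∘ ((↑) : ℝ → UnitAddCircle)) ∧
      HasCompactSupport b ∧ tsupport b ⊆ U ∧ (∀ z, 0 ≤ b z) ∧ 0 < b y := by
  let m : UnitAddCircle → ℝ := fun z => 1 - ((AddCircle.toCircle (z - y) : Circle) : ℂ).re
  have hm : Continuous m := by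
    refine continuous_const.sub (Complex.continuous_re.comp (continuous_subtype_val.comp ?_))
    exact AddCircle.continuous_toCircle.comp (continuous_id.sub continuous_const)
  have hm_pos : ∀ z, z ≠ y → 0 < m z := by
    intro z hz
    have hn : ‖((AddCircle.toCircle (z - y) : Circle) : ℂ)‖ = 1 := Circle.norm_coe _
    refine sub_pos.2 (lt_of_le_of_ne ((Complex.re_le_norm _).trans hn.le) fun h => hz ?_)
    have h1 : ((AddCircle.toCircle (z - y) : Circle) : ℂ) = 1 := by
      have := Complex.re_eq_norm.1 (h.trans hn.symm)
      refine Complex.ext h ?_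
      simpa using this.2.symm
    have h2 : AddCircle.toCircle (z - y) = AddCircle.toCircle (0 : UnitAddCircle) := by
      rw [AddCircle.toCircle_zero]
      exact Circle.coe_eq_one.1 h1
    exact sub_eq_zero.1 (AddCircle.injective_toCircle one_ne_zero h2)
  have hmy : m y = 0 := by simp [m]
  obtain ⟨δ, hδ, hδU⟩ : ∃ δ > 0, ∀ z, m z ≤ δ → z ∈ U := by
    rcases (interior U)ᶜ.eq_empty_or_nonempty with h | h
    · exact ⟨1, one_pos, fun z _ => interior_subset (compl_empty_iff.1 h ▸ mem_univ z)⟩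
    · obtain ⟨z₀, hz₀, hmin⟩ :=
        isOpen_interior.isClosed_compl.isCompact.exists_isMinOn h hm.continuousOn
      have hpos : 0 < m z₀ := hm_pos _ fun h => hz₀ (h ▸ mem_interior_iff_mem_nhds.2 hU)
      refine ⟨m z₀ / 2, half_pos hpos, fun z hz => interior_subset (by_contra fun hzU => ?_)⟩
      have h3 : m z₀ ≤ m z := hmin hzU
      linarith
  have hsub : tsupport (fun z => expNegInvGlue (δ - m z)) ⊆ {z | m z ≤ δ} := by
    refine closure_minimal (fun z hz => ?_) (isClosed_le hm continuous_const)
    by_contra h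
    exact hz (expNegInvGlue.zero_of_nonpos (by simp only [mem_ofPred_eq, not_le] at h; linarith))
  refine ⟨fun z => expNegInvGlue (δ - m z), ?_, HasCompactSupport.of_compactSpace _,
    hsub.trans hδU, fun z => expNegInvGlue.nonneg _, expNegInvGlue.pos_of_pos (by linarith)⟩
  refine expNegInvGlue.contDiff.comp (contDiff_const.sub (contDiff_const.sub ?_))
  obtain ⟨a, rfl⟩ := QuotientAddGroup.mk_surjective y
  have : (fun t : ℝ => ((AddCircle.toCircle ((t : UnitAddCircle) - (a : UnitAddCircle)) : Circle) :
      ℂ).re) = fun t : ℝ => Real.cos (2 * Real.pi * (t - a)) := by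
    funext t
    rw [← AddCircle.coe_sub, AddCircle.toCircle_apply_mk, Circle.coe_exp, Complex.exp_ofReal_mul_I_re]
    simp
  exact this ▸ Real.contDiff_cos.comp (contDiff_const.mul (contDiff_id.sub contDiff_const))

theorem isUnfolding_circle : IsUnfolding (fun t : ℝ => (t : UnitAddCircle)) circleWeight where
  map_add v w := AddCircle.coe_add _ v w
  isOpenQuotientMap := QuotientAddGroup.isOpenQuotientMap_mk
  contDiff := contDiff_circleWeight
  nonneg := circleWeight_nonneg
  exists_isCompact K _ := ⟨Icc (-1) 1, isCompact_Icc, fun v hv _ =>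
    Ioc_subset_Icc_self (by_contra fun h => hv (circleWeight_eq_zero h))⟩
  map_eq := by
    have hc : Measurable fun t => ENNReal.ofReal (circleWeight t) :=
      contDiff_circleWeight.continuous.measurable.ennreal_ofReal
    ext s hs
    have hi : Measurable (s.indicator (1 : UnitAddCircle → ENNReal)) := measurable_one.indicator hs
    have hi' : Measurable fun t : ℝ => s.indicator (1 : UnitAddCircle → ENNReal) t :=
      hi.comp AddCircle.measurable_mk'
    rw [← lintegral_indicator_one hs, lintegral_map hi AddCircle.measurable_mk',
      lintegral_withDensity_eq_lintegral_mul _ hc hi',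
      ← lintegral_indicator_one (μ := volume) hs, ← lintegral_circleWeight _ hi]
    rfl
  exists_bump := UnitAddCircle.exists_bump

/-- The weight on `ℝ²` whose translates under `ℤ²` add up to `1`. -/
def torusWeight (v : ℝ × ℝ) : ℝ := circleWeight v.1 * circleWeight v.2

/-- The weight on `ℝ² × ℝ` whose translates under `ℤ²` add up to `1`. -/
def groupoidWeight (v : (ℝ × ℝ) × ℝ) : ℝ := torusWeight v.1 * 1

theorem isUnfolding_torus : IsUnfolding torusMk torusWeight :=
  isUnfolding_circle.prodMap isUnfolding_circle

theorem isUnfolding_groupoid : IsUnfolding groupoidMk groupoidWeight :=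
  isUnfolding_torus.prodMap isUnfolding_id

end Unfolding

instance : (volume : Measure Torus).IsAddHaarMeasure :=
  Measure.prod.instIsAddHaarMeasure _ _

instance : (volume : Measure Groupoid).IsAddHaarMeasure :=
  Measure.prod.instIsAddHaarMeasure _ _

instance : (volume : Measure (ℝ × ℝ)).IsAddHaarMeasure :=
  Measure.prod.instIsAddHaarMeasure _ _

instance : (volume : Measure ((ℝ × ℝ) × ℝ)).IsAddHaarMeasure :=
  Measure.prod.instIsAddHaarMeasure _ _

/-! ### Densities and their lifts to the covering space -/

section Densities

variable {F Y : Type} [NormedAddCommGroup F] [NormedSpace ℝ F] [TopologicalSpace Y]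
  {e : F → Y} {S : Set Y}

/-- The density with a given coefficient. -/
def Dens.mk (f : Y → ℂ) (hf : f ∈ densities e S) : Dens e S := ⟨f, hf⟩

@[simp] theorem Dens.coeff_mk (f : Y → ℂ) (hf : f ∈ densities e S) : (Dens.mk f hf).coeff = f := rfl

theorem Dens.coeff_mem (f : Dens e S) : f.coeff ∈ densities e S := f.2

theorem Dens.ext {f g : Dens e S} (h : f.coeff = g.coeff) : f = g := Subtype.ext h

theorem densities_mono {S T : Set Y} (h : S ⊆ T) : densities e S ≤ densities e T :=
  fun _ hf => ⟨hf.1, hf.2.1, hf.2.2.trans h⟩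

end Densities

section Unfolding

variable {F Y : Type} [NormedAddCommGroup F] [NormedSpace ℝ F] [MeasureSpace F] [BorelSpace F]
  [AddCommGroup Y] [TopologicalSpace Y] [MeasureSpace Y] [BorelSpace Y]
  {e : F → Y} {θ : F → ℝ}

namespace IsUnfolding

theorem map_zero (h : IsUnfolding e θ) : e 0 = 0 := by
  have := h.map_add 0 0
  simpa using this

theorem map_neg (h : IsUnfolding e θ) (v : F) : e (-v) = -e v := by
  rw [eq_neg_iff_add_eq_zero, ← h.map_add, neg_add_cancel, h.map_zero]

theorem map_sub (h : IsUnfolding e θ) (v w : F) : e (v - w) = e v - e w := by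
  rw [sub_eq_add_neg, h.map_add, h.map_neg, sub_eq_add_neg]

theorem continuous (h : IsUnfolding e θ) : Continuous e := h.isOpenQuotientMap.continuous

theorem continuous_of_contDiff (h : IsUnfolding e θ) {f : Y → ℂ} (hf : ContDiff ℝ ∞ (f ∘ e)) :
    Continuous f :=
  h.isOpenQuotientMap.isQuotientMap.continuous_iff.2 hf.continuous

theorem continuous_of_mem (h : IsUnfolding e θ) {S : Set Y} {f : Y → ℂ} (hf : f ∈ densities e S) :
    Continuous f :=
  h.continuous_of_contDiff hf.1

theorem integral_comp (h : IsUnfolding e θ) {f : Y → ℂ} (hf : AEStronglyMeasurable f volume) :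
    ∫ v, (θ v : ℂ) * f (e v) = ∫ y, f y := by
  have hθ : Measurable fun v => ENNReal.ofReal (θ v) :=
    h.contDiff.continuous.measurable.ennreal_ofReal
  have hm : AEStronglyMeasurable f
      ((volume.withDensity fun v => ENNReal.ofReal (θ v)).map e) := by rwa [h.map_eq]
  rw [← h.map_eq, integral_map h.continuous.measurable.aemeasurable hm,
    integral_withDensity_eq_integral_toReal_smul hθ (ae_of_all _ fun _ => ENNReal.ofReal_lt_top)]
  simp [ENNReal.toReal_ofReal (h.nonneg _)]

theorem hasCompactSupport (h : IsUnfolding e θ) {f : Y → ℂ} (hf : HasCompactSupport f) :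
    HasCompactSupport fun v => (θ v : ℂ) * f (e v) := by
  obtain ⟨K, hK, hK'⟩ := h.exists_isCompact _ hf
  refine HasCompactSupport.intro hK fun v hv => ?_
  by_contra hne
  refine hv (hK' v ?_ (subset_tsupport _ (right_ne_zero_of_mul hne)))
  exact_mod_cast left_ne_zero_of_mul hne

theorem contDiff_weight_mul (h : IsUnfolding e θ) {f : Y → ℂ} (hf : ContDiff ℝ ∞ (f ∘ e)) :
    ContDiff ℝ ∞ fun v => (θ v : ℂ) * f (e v) :=
  (Complex.ofRealCLM.contDiff.comp h.contDiff).mul hf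

theorem weight_mul_mem (h : IsUnfolding e θ) {S : Set Y} {f : Y → ℂ} (hf : f ∈ densities e S) :
    (fun v => (θ v : ℂ) * f (e v)) ∈ densities (id : F → F) (e ⁻¹' S) := by
  refine ⟨h.contDiff_weight_mul hf.1, h.hasCompactSupport hf.2.1, ?_⟩
  exact (tsupport_mul_subset_right (f := fun v => (θ v : ℂ)) (g := fun v => f (e v))).trans
    ((tsupport_comp_subset_preimage f h.continuous).trans (preimage_mono hf.2.2))

end IsUnfolding

end Unfolding

/-! ### A continuous density is determined by its integrals -/

section Pairing

variable {Y : Type} [TopologicalSpace Y] [MeasureSpace Y] [OpensMeasurableSpace Y]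
  [IsFiniteMeasureOnCompacts (volume : Measure Y)]

theorem integrable_mul_test {g u : Y → ℂ} (hg : Continuous g) (hg' : HasCompactSupport g)
    (hu : Continuous u) : Integrable fun y => g y * u y :=
  (hg.mul hu).integrable_of_hasCompactSupport hg'.mul_right

/-- A compactly supported continuous density is determined by its integrals. -/
theorem eq_of_forall_integral_eq [(volume : Measure Y).IsOpenPosMeasure] {g g' : Y → ℂ}
    (hg : Continuous g) (hgc : HasCompactSupport g) (hg' : Continuous g')
    (hgc' : HasCompactSupport g')
    (h : ∀ u : C(Y, ℂ), ∫ y, g y * u y = ∫ y, g' y * u y) : g = g' := by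
  have hd : Continuous (g - g') := hg.sub hg'
  have hdc : HasCompactSupport (g - g') := hgc.sub hgc'
  by_contra hne
  obtain ⟨y, hy⟩ : ∃ y, (g - g') y ≠ 0 := by
    by_contra! h0
    exact hne (sub_eq_zero.1 (funext h0))
  -- Testing against the conjugate of the difference gives the integral of `|g - g'|²`, which is
  -- positive unless `g = g'`.
  let u : C(Y, ℂ) := ⟨fun y => starRingEnd ℂ ((g - g') y), Complex.continuous_conj.comp hd⟩
  have h1 : ∫ y, (g - g') y * u y = 0 := by
    simp only [Pi.sub_apply, sub_mul]
    rw [integral_sub (integrable_mul_test hg hgc u.continuous)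
      (integrable_mul_test hg' hgc' u.continuous), h u, sub_self]
  have h2 : ∫ y, Complex.normSq ((g - g') y) = 0 := by
    have : ((∫ y, Complex.normSq ((g - g') y) : ℝ) : ℂ) = ∫ y, (g - g') y * u y := by
      rw [← integral_complex_ofReal]
      exact integral_congr_ae (ae_of_all _ fun y => (Complex.mul_conj _).symm)
    exact_mod_cast this.trans h1
  have h3 : 0 < ∫ y, Complex.normSq ((g - g') y) :=
    (Complex.continuous_normSq.comp hd).integral_pos_of_hasCompactSupport_nonneg_nonzero
      (hdc.comp_left (g := Complex.normSq) (by simp)) (fun y => Complex.normSq_nonneg _)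
      (x := y) (by simpa using hy)
  exact h3.ne' h2

theorem IsFiberIntegral.eq [(volume : Measure Y).IsOpenPosMeasure] {X : Type} [MeasureSpace X]
    {φ : X → Y} {f : X → ℂ} {g g' : Y → ℂ} (h : IsFiberIntegral φ f g)
    (h' : IsFiberIntegral φ f g') (hg : Continuous g) (hgc : HasCompactSupport g)
    (hg' : Continuous g') (hgc' : HasCompactSupport g') : g = g' :=
  eq_of_forall_integral_eq hg hgc hg' hgc' fun u => (h u).symm.trans (h' u)

end Pairing

/-! ### Convolution and involution on an abelian group -/

section Convolution

variable {Y : Type} [AddCommGroup Y] [TopologicalSpace Y] [IsTopologicalAddGroup Y] [T2Space Y]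
  [LocallyCompactSpace Y] [SecondCountableTopology Y] [MeasureSpace Y] [BorelSpace Y]
  [(volume : Measure Y).IsAddHaarMeasure]

/-- The convolution `m_!(a ⊗ b)` on an abelian group. -/
def conv (a b : Y → ℂ) (y : Y) : ℂ := ∫ x, a x * b (y - x)

theorem conv_eq_convolution (a b : Y → ℂ) :
    conv a b = convolution a b (ContinuousLinearMap.mul ℂ ℂ) volume := rfl

theorem hasCompactSupport_conv {a b : Y → ℂ} (ha : HasCompactSupport a)
    (hb : HasCompactSupport b) : HasCompactSupport (conv a b) := by
  rw [conv_eq_convolution]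
  exact ha.convolution _ hb

theorem integrable_conv {a b : Y → ℂ} (ha : Continuous a) (hac : HasCompactSupport a)
    (hb : Continuous b) (y : Y) : Integrable fun x => a x * b (y - x) :=
  integrable_mul_test ha hac (hb.comp (continuous_const.sub continuous_id))

theorem integrable_tensor {Z : Type} [TopologicalSpace Z] [T2Space Z] [MeasureSpace Z]
    [SecondCountableTopology Z] [BorelSpace Z] [SFinite (volume : Measure Z)]
    [IsFiniteMeasureOnCompacts (volume : Measure Z)] {b : Z → ℂ} {a : Y → ℂ}
    {u : Y × Z → ℂ} (ha : Continuous a) (hac : HasCompactSupport a)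
    (hb : Continuous b) (hbc : HasCompactSupport b) (hu : Continuous u) :
    Integrable fun z : Y × Z => a z.1 * b z.2 * u z := by
  refine (((ha.comp continuous_fst).mul (hb.comp continuous_snd)).mul
    hu).integrable_of_hasCompactSupport ?_
  refine HasCompactSupport.intro (IsCompact.prod hac hbc) fun z hz => ?_
  by_contra hne
  have := left_ne_zero_of_mul hne
  exact hz ⟨subset_tsupport _ (left_ne_zero_of_mul this),
    subset_tsupport _ (right_ne_zero_of_mul this)⟩

theorem continuous_integral_mul_comp_add {X : Type} [TopologicalSpace X] [AddCommGroup X]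
    [ContinuousAdd X] {φ : Y → X} (hφ : Continuous φ)
    {b : Y → ℂ} (hb : Continuous b) (hbc : HasCompactSupport b) {u : X → ℂ} (hu : Continuous u) :
    Continuous fun x => ∫ y, b y * u (x + φ y) := by
  rw [← continuousOn_univ]
  refine continuousOn_integral_of_compact_support hbc ?_ fun p x _ hx => ?_
  · refine Continuous.continuousOn ?_
    exact (hb.comp continuous_snd).mul (hu.comp (continuous_fst.add (hφ.comp continuous_snd)))
  · rw [image_eq_zero_of_notMem_tsupport hx, zero_mul]

theorem isConvolution_iff {a b c : Y → ℂ} (ha : Continuous a) (hac : HasCompactSupport a)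
    (hb : Continuous b) (hbc : HasCompactSupport b) :
    IsConvolution a b c ↔
      ∀ u : C(Y, ℂ), ∫ x, a x * ∫ y, b y * u (x + y) = ∫ y, c y * u y := by
  refine forall_congr' fun u => ?_
  have hi := integrable_tensor ha hac hb hbc (u.continuous.comp continuous_add)
  have h1 : ∫ z : Y × Y, a z.1 * b z.2 * u (z.1 + z.2) = ∫ x, a x * ∫ y, b y * u (x + y) := by
    rw [Measure.volume_eq_prod]
    refine (integral_prod _ hi).trans ?_
    simp only [mul_assoc, integral_const_mul, Function.comp_apply]
  rw [← h1]

theorem isConvolution_conv {a b : Y → ℂ} (ha : Continuous a) (hac : HasCompactSupport a)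
    (hb : Continuous b) (hbc : HasCompactSupport b) : IsConvolution a b (conv a b) := by
  refine (isConvolution_iff ha hac hb hbc).2 fun u => ?_
  have h1 : ∀ x, a x * ∫ y, b y * u (x + y) = ∫ y, a x * b (y - x) * u y := fun x => by
    rw [← integral_const_mul,
      ← integral_add_right_eq_self (fun y => a x * b (y - x) * u y) x]
    refine integral_congr_ae (ae_of_all _ fun y => ?_)
    simp only [add_sub_cancel_right, mul_assoc, add_comm x y]
  simp_rw [h1]
  rw [integral_integral_swap_of_hasCompactSupport]
  · refine integral_congr_ae (ae_of_all _ fun y => ?_)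
    simp only [integral_mul_const, conv]
  · exact ((ha.comp continuous_fst).mul (hb.comp (continuous_snd.sub continuous_fst))).mul
      (u.continuous.comp continuous_snd)
  -- The integrand lives on the image of the product of the supports under the shear `(x, y) ↦ (x, x
  -- + y)`.
  · refine HasCompactSupport.intro
      (K := (fun z : Y × Y => (z.1, z.1 + z.2)) '' (tsupport a ×ˢ tsupport b)) ?_ fun z hz => ?_
    · exact (IsCompact.prod hac hbc).image
        (continuous_fst.prodMk (continuous_fst.add continuous_snd))
    · by_contra hne
      have := left_ne_zero_of_mul hne
      exact hz ⟨(z.1, z.2 - z.1), ⟨subset_tsupport _ (left_ne_zero_of_mul this),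
        subset_tsupport _ (right_ne_zero_of_mul this)⟩, by simp⟩

theorem integral_conv_mul {a b : Y → ℂ} (ha : Continuous a) (hac : HasCompactSupport a)
    (hb : Continuous b) (hbc : HasCompactSupport b) (u : C(Y, ℂ)) :
    ∫ y, conv a b y * u y = ∫ x, a x * ∫ y, b y * u (x + y) :=
  ((isConvolution_iff ha hac hb hbc).1 (isConvolution_conv ha hac hb hbc) u).symm

/-- Paired with `u`, both sides become the triple integral of `a(x) b(y) c(z) u(x + y + z)`, by
repeated use of the weak description of the convolution. -/
theorem conv_assoc {a b c : Y → ℂ} (ha : Continuous a) (hac : HasCompactSupport a)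
    (hb : Continuous b) (hbc : HasCompactSupport b) (hc : Continuous c)
    (hcc : HasCompactSupport c) (hab : Continuous (conv a b)) (hbc' : Continuous (conv b c))
    (habc : Continuous (conv (conv a b) c)) (habc' : Continuous (conv a (conv b c))) :
    conv (conv a b) c = conv a (conv b c) := by
  have kab := hasCompactSupport_conv hac hbc
  have kbc := hasCompactSupport_conv hbc hcc
  refine eq_of_forall_integral_eq habc (hasCompactSupport_conv kab hcc) habc'
    (hasCompactSupport_conv hac kbc) fun u => ?_
  rw [integral_conv_mul hab kab hc hcc, integral_conv_mul ha hac hbc' kbc]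
  have hU := continuous_integral_mul_comp_add (X := Y) continuous_id hc hcc u.continuous
  have h1 := integral_conv_mul ha hac hb hbc ⟨_, hU⟩
  simp only [ContinuousMap.coe_mk, id] at h1
  rw [h1]
  refine integral_congr_ae (ae_of_all _ fun x => ?_)
  have h2 := integral_conv_mul hb hbc hc hcc (u.comp (ContinuousMap.addLeft x))
  simp only [ContinuousMap.comp_apply, ContinuousMap.coe_addLeft] at h2
  simp only [h2, add_assoc]

theorem involution_conv (a b : Y → ℂ) :
    involution (conv a b) = conv (involution b) (involution a) := by
  funext y
  simp only [involution, conv]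
  rw [← integral_conj, ← integral_add_right_eq_self
    (fun x => starRingEnd ℂ (b (-x)) * starRingEnd ℂ (a (-(y - x)))) y]
  refine integral_congr_ae (ae_of_all _ fun x => ?_)
  simp only [map_mul]
  rw [mul_comm]
  congr 3 <;> abel

end Convolution

/-! ### The convolution algebra of smooth densities -/

section Algebra

variable {F Y : Type} [NormedAddCommGroup F] [NormedSpace ℝ F] [FiniteDimensional ℝ F]
  [MeasureSpace F] [BorelSpace F] [(volume : Measure F).IsAddHaarMeasure]
  [AddCommGroup Y] [TopologicalSpace Y] [IsTopologicalAddGroup Y] [T2Space Y]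
  [LocallyCompactSpace Y] [SecondCountableTopology Y] [MeasureSpace Y] [BorelSpace Y]
  [(volume : Measure Y).IsAddHaarMeasure]
  {e : F → Y} {θ : F → ℝ}

/-- Lifted through `e`, the convolution is an ordinary convolution on `F` of `b ∘ e` with `θ · (a ∘
e)`. The latter is smooth with compact support, hence so is the smoothness of the result. -/
theorem IsUnfolding.conv_mem (h : IsUnfolding e θ) {a b : Y → ℂ} (ha : a ∈ densities e univ)
    (hb : b ∈ densities e univ) : conv a b ∈ densities e univ := by
  refine ⟨?_, hasCompactSupport_conv ha.2.1 hb.2.1, subset_univ _⟩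
  have hconv : conv a b ∘ e = convolution (fun v => (θ v : ℂ) * a (e v)) (b ∘ e)
      (ContinuousLinearMap.mul ℝ ℂ) volume := by
    funext v
    rw [Function.comp_apply, conv, ← h.integral_comp
      (integrable_conv (h.continuous_of_mem ha) ha.2.1 (h.continuous_of_mem hb) _).1]
    refine integral_congr_ae (ae_of_all _ fun w => ?_)
    simp [h.map_sub, mul_assoc]
  rw [hconv]
  exact (h.hasCompactSupport ha.2.1).contDiff_convolution_left _ (h.contDiff_weight_mul ha.1)
    hb.1.continuous.locallyIntegrable

theorem IsUnfolding.involution_mem (h : IsUnfolding e θ) {a : Y → ℂ}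
    (ha : a ∈ densities e univ) : involution a ∈ densities e univ := by
  refine ⟨?_, ?_, subset_univ _⟩
  · have : involution a ∘ e = Complex.conjCLE ∘ (a ∘ e) ∘ Neg.neg := by
      funext v
      simp [involution, h.map_neg]
    rw [this]
    exact Complex.conjCLE.contDiff.comp (ha.1.comp contDiff_neg)
  · exact (ha.2.1.comp_homeomorph (Homeomorph.neg Y)).comp_left (_root_.map_zero (starRingEnd ℂ))

theorem IsUnfolding.isConvolution_iff_eq (h : IsUnfolding e θ) {a b c : Y → ℂ}
    (ha : a ∈ densities e univ) (hb : b ∈ densities e univ) (hc : c ∈ densities e univ) :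
    IsConvolution a b c ↔ c = conv a b := by
  have h1 := isConvolution_conv (h.continuous_of_mem ha) ha.2.1 (h.continuous_of_mem hb) hb.2.1
  refine ⟨fun h2 => ?_, fun h2 => h2 ▸ h1⟩
  exact IsFiberIntegral.eq h2 h1 (h.continuous_of_mem hc) hc.2.1
    (h.continuous_of_mem (h.conv_mem ha hb)) (hasCompactSupport_conv ha.2.1 hb.2.1)

/-- The `*`-algebra of compactly supported smooth densities on the group `Y`. -/
def IsUnfolding.starAlg (h : IsUnfolding e θ) : StarAlg (densities e univ) where
  mul := LinearMap.mk₂ ℂ (fun a b => ⟨conv a b, h.conv_mem a.2 b.2⟩)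
    (fun a a' b => Subtype.ext <| funext fun y => by
      have hb := h.continuous_of_mem b.2
      simp only [Submodule.coe_add, conv, Pi.add_apply, add_mul]
      exact integral_add (integrable_conv (h.continuous_of_mem a.2) a.2.2.1 hb y)
        (integrable_conv (h.continuous_of_mem a'.2) a'.2.2.1 hb y))
    (fun r a b => Subtype.ext <| funext fun y => by
      simp only [Submodule.coe_smul, conv, Pi.smul_apply, smul_eq_mul, mul_assoc,
        integral_const_mul])
    (fun a b b' => Subtype.ext <| funext fun y => by
      have ha := h.continuous_of_mem a.2
      simp only [Submodule.coe_add, conv, Pi.add_apply, mul_add]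
      exact integral_add (integrable_conv ha a.2.2.1 (h.continuous_of_mem b.2) y)
        (integrable_conv ha a.2.2.1 (h.continuous_of_mem b'.2) y))
    (fun r a b => Subtype.ext <| funext fun y => by
      simp only [Submodule.coe_smul, conv, Pi.smul_apply, smul_eq_mul, mul_left_comm _ r,
        integral_const_mul])
  star :=
    { toFun := fun a => ⟨involution a, h.involution_mem a.2⟩
      map_add' := fun a b => Subtype.ext <| funext fun y => by simp [involution]
      map_smul' := fun r a => Subtype.ext <| funext fun y => by simp [involution] }
  mul_assoc a b c := Subtype.ext <|
    conv_assoc (h.continuous_of_mem a.2) a.2.2.1 (h.continuous_of_mem b.2) b.2.2.1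
      (h.continuous_of_mem c.2) c.2.2.1 (h.continuous_of_mem (h.conv_mem a.2 b.2))
      (h.continuous_of_mem (h.conv_mem b.2 c.2))
      (h.continuous_of_mem (h.conv_mem (h.conv_mem a.2 b.2) c.2))
      (h.continuous_of_mem (h.conv_mem a.2 (h.conv_mem b.2 c.2)))
  star_star a := Subtype.ext <| funext fun y => by simp [involution]
  star_mul a b := Subtype.ext (involution_conv _ _)

@[simp] theorem IsUnfolding.coe_starAlg_mul (h : IsUnfolding e θ) (a b : densities e univ) :
    (h.starAlg.mul a b : Y → ℂ) = conv a b := rfl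

end Algebra

/-! ### Gluing densities from the members of a cover -/

section Total

variable {F Y : Type} [NormedAddCommGroup F] [NormedSpace ℝ F] [TopologicalSpace Y]
  {e : F → Y} {ι : Type} [DecidableEq ι] {O : ι → Set Y}

@[simp] theorem total_lof (i : ι) (f : Dens e (O i)) :
    total e O (DirectSum.lof ℂ ι (fun i => Dens e (O i)) i f) = f.coeff :=
  DirectSum.toModule_lof ..

theorem total_mem (x : ⨁ i, Dens e (O i)) : total e O x ∈ densities e univ := by
  induction x using DirectSum.induction_on with
  | zero => rw [_root_.map_zero]; exact zero_mem _
  | of i f => exact (total_lof i f) ▸ densities_mono (subset_univ _) f.coeff_mem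
  | add x y hx hy => rw [_root_.map_add]; exact add_mem hx hy

end Total

/-- A partition of unity: finitely many bumps, each supported in a member of the cover, have
positive sum on the support of `f`; dividing by that sum splits `f`. -/
theorem IsUnfolding.exists_total_eq {F Y : Type} [NormedAddCommGroup F] [NormedSpace ℝ F]
    [MeasureSpace F] [BorelSpace F] [AddCommGroup Y] [TopologicalSpace Y] [MeasureSpace Y]
    [BorelSpace Y] {e : F → Y} {θ : F → ℝ} (h : IsUnfolding e θ) {ι : Type} [DecidableEq ι]
    {O : ι → Set Y} (hO : ∀ i, IsOpen (O i)) (hcover : ⋃ i, O i = univ) {f : Y → ℂ}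
    (hf : f ∈ densities e univ) : ∃ x, total e O x = f := by
  have hi : ∀ y : Y, ∃ i, y ∈ O i := fun y => mem_iUnion.1 (hcover ▸ mem_univ y)
  choose i hi using hi
  choose b hb hbc hbs hb0 hbp using fun y => h.exists_bump y (O (i y)) ((hO _).mem_nhds (hi y))
  have hbcont : ∀ y, Continuous (b y) := fun y =>
    h.isOpenQuotientMap.isQuotientMap.continuous_iff.2 (hb y).continuous
  obtain ⟨t, -, ht⟩ := hf.2.1.elim_nhds_subcover (fun y => {z | 0 < b y z})
    fun y _ => (isOpen_lt continuous_const (hbcont y)).mem_nhds (hbp y)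
  have hpos : ∀ z ∈ tsupport f, 0 < ∑ y ∈ t, b y z := fun z hz => by
    obtain ⟨y, hy, hyz⟩ := mem_iUnion₂.1 (ht hz)
    exact Finset.sum_pos' (fun y _ => hb0 y z) ⟨y, hy, hyz⟩
  let g : Y → Y → ℂ := fun y z => ((b y z / ∑ y ∈ t, b y z : ℝ) : ℂ) * f z
  have hgf : ∀ y, tsupport (g y) ⊆ tsupport f := fun y =>
    tsupport_mul_subset_right
  have hg : ∀ y, g y ∈ densities e (O (i y)) := by
    refine fun y => ⟨?_, ?_, ?_⟩
    -- The denominator is known to be positive only on the support of `f`; away from the support of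
    -- the product the function is locally zero.
    · refine contDiff_iff_contDiffAt.2 fun v => ?_
      by_cases hv : v ∈ tsupport (g y ∘ e)
      swap
      · exact contDiffAt_const.congr_of_eventuallyEq (notMem_tsupport_iff_eventuallyEq.1 hv)
      have hv' : e v ∈ tsupport f := hgf y (tsupport_comp_subset_preimage _ h.continuous hv)
      have hs : ContDiff ℝ ∞ fun v => ∑ y ∈ t, b y (e v) := ContDiff.sum fun y _ => hb y
      exact (Complex.ofRealCLM.contDiff.contDiffAt.comp v
        ((hb y).contDiffAt.div hs.contDiffAt (hpos _ hv').ne')).mul hf.1.contDiffAt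
    · exact hf.2.1.of_isClosed_subset (isClosed_tsupport _) (hgf y)
    · refine (closure_mono fun z hz => ?_).trans (hbs y)
      intro h0
      exact hz (by simp [g, h0])
  refine ⟨∑ y ∈ t, DirectSum.lof ℂ ι (fun i => Dens e (O i)) (i y) (Dens.mk _ (hg y)), ?_⟩
  rw [map_sum]
  simp only [total_lof, Dens.coeff_mk]
  funext z
  simp only [Finset.sum_apply, g]
  rw [← Finset.sum_mul, ← Complex.ofReal_sum, ← Finset.sum_div]
  by_cases hz : z ∈ tsupport f
  · rw [div_self (hpos z hz).ne']
    simp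
  · rw [image_eq_zero_of_notMem_tsupport hz, mul_zero]

/-! ### Submersions, and densities supported in their domains -/

section Submersions

variable {F Y : Type} [NormedAddCommGroup F] [NormedSpace ℝ F] {e : F → Y} {n : ℕ}

theorem IsSubmersionOn.mono {U U' : Set (Fin n → ℝ)} {p : (Fin n → ℝ) → Y}
    (hp : IsSubmersionOn e U p) (h : U' ⊆ U) : IsSubmersionOn e U' p :=
  fun x hx => hp x (h hx)

theorem IsSubmersionOn.continuousOn [TopologicalSpace Y] (he : Continuous e)
    {U : Set (Fin n → ℝ)} {p : (Fin n → ℝ) → Y} (hp : IsSubmersionOn e U p) :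
    ContinuousOn p U := fun x hx => by
  obtain ⟨P, hP, -⟩ := hp x hx
  exact ((he.continuousAt.comp hP.self_of_nhds.1.continuousAt).congr
    (hP.mono fun y hy => hy.2.symm)).continuousWithinAt

theorem isSubmersionOn_equiv (U : Set (Fin n → ℝ)) (L : (Fin n → ℝ) ≃L[ℝ] F) :
    IsSubmersionOn e U (e ∘ L) := fun x _ =>
  ⟨L, Eventually.of_forall fun _ => ⟨L.contDiff.contDiffAt, rfl⟩, by
    rw [L.fderiv]; exact L.surjective⟩

theorem isSubmersionOn_id (U : Set (Fin n → ℝ)) :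
    IsSubmersionOn (id : (Fin n → ℝ) → (Fin n → ℝ)) U id :=
  isSubmersionOn_equiv U (ContinuousLinearEquiv.refl ℝ _)

end Submersions

/-- The maps `p` and `q` of a relation are total functions with arbitrary values off `W`. This lemma
and the next make products with a density supported in `W` continuous and integrable all the same.
-/
theorem continuous_mul_of_tsupport_subset {X : Type} [TopologicalSpace X] {f h : X → ℂ}
    {S : Set X} (hf : Continuous f) (hS : IsOpen S) (hfS : tsupport f ⊆ S)
    (hh : ContinuousOn h S) : Continuous fun x => f x * h x := by
  refine continuous_iff_continuousAt.2 fun x => ?_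
  by_cases hx : x ∈ tsupport f
  · exact hf.continuousAt.mul (hh.continuousAt (hS.mem_nhds (hfS hx)))
  · refine (continuousAt_const (y := (0 : ℂ))).congr ?_
    filter_upwards [notMem_tsupport_iff_eventuallyEq.1 hx] with y hy
    simp [hy]

theorem integrable_mul_of_tsupport_subset {X : Type} [TopologicalSpace X] [MeasureSpace X]
    [OpensMeasurableSpace X] [IsFiniteMeasureOnCompacts (volume : Measure X)] {f h : X → ℂ}
    {S : Set X} (hf : Continuous f) (hfc : HasCompactSupport f) (hS : IsOpen S)
    (hfS : tsupport f ⊆ S) (hh : ContinuousOn h S) : Integrable fun x => f x * h x :=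
  (continuous_mul_of_tsupport_subset hf hS hfS hh).integrable_of_hasCompactSupport
    hfc.mul_right

theorem Dens.continuous {E : Type} [NormedAddCommGroup E] [NormedSpace ℝ E] {W : Set E}
    (f : Dens (id : E → E) W) : Continuous f.coeff :=
  f.coeff_mem.1.continuous

theorem Dens.integrable_mul_comp {Y : Type} [TopologicalSpace Y] {n : ℕ} {W : Set (Fin n → ℝ)}
    (f : Dens (id : (Fin n → ℝ) → (Fin n → ℝ)) W) (hW : IsOpen W) {p : (Fin n → ℝ) → Y}
    (hp : ContinuousOn p W) {u : Y → ℂ} (hu : Continuous u) :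
    Integrable fun y => f.coeff y * u (p y) :=
  integrable_mul_of_tsupport_subset f.continuous f.coeff_mem.2.1 hW f.coeff_mem.2.2
    (hu.comp_continuousOn hp)

/-- This is how a partition of unity on `Y` is pulled back along `p` to cut the data of a relation
into pieces that map into single members of the cover. -/
theorem mul_comp_mem_densities {F Y : Type} [NormedAddCommGroup F] [NormedSpace ℝ F]
    [TopologicalSpace Y] {e : F → Y} (he : Continuous e) {n : ℕ} {W : Set (Fin n → ℝ)}
    {f : (Fin n → ℝ) → ℂ} (hf : f ∈ densities id W)
    {p : (Fin n → ℝ) → Y} (hp : IsSubmersionOn e W p) {S : Set Y} {φ : Y → ℂ}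
    (hφ : φ ∈ densities e S) :
    (fun y => f y * φ (p y)) ∈ densities (id : (Fin n → ℝ) → (Fin n → ℝ)) (W ∩ p ⁻¹' S) := by
  refine ⟨?_, hf.2.1.mul_right, ?_⟩
  · refine contDiff_iff_contDiffAt.2 fun y => ?_
    by_cases hy : y ∈ tsupport f
    · obtain ⟨P, hP, -⟩ := hp y (hf.2.2 hy)
      have h1 : ContDiffAt ℝ ∞ (fun y => φ (p y)) y :=
        (hφ.1.contDiffAt.comp y hP.self_of_nhds.1).congr_of_eventuallyEq
          (hP.mono fun z hz => congrArg φ hz.2)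
      exact ContDiffAt.mul (hf.1.contDiffAt (x := y)) h1
    · refine (contDiffAt_const (c := (0 : ℂ))).congr_of_eventuallyEq ?_
      filter_upwards [notMem_tsupport_iff_eventuallyEq.1 hy] with z hz
      simp [hz]
  · have hcl : IsClosed (tsupport f ∩ p ⁻¹' tsupport φ) :=
      ((hp.mono hf.2.2).continuousOn he).preimage_isClosed_of_isClosed (isClosed_tsupport f)
        (isClosed_tsupport φ)
    refine (closure_minimal (fun y hy => ?_) hcl).trans
      (inter_subset_inter hf.2.2 (preimage_mono hφ.2.2))
    exact ⟨subset_tsupport _ (left_ne_zero_of_mul hy), subset_tsupport _ (right_ne_zero_of_mul hy)⟩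

theorem exists_finset_eq_sum_lof {F Y ι : Type} [NormedAddCommGroup F] [NormedSpace ℝ F]
    [TopologicalSpace Y] [DecidableEq ι] {e : F → Y} {O : ι → Set Y} (x : ⨁ i, Dens e (O i)) :
    ∃ (s : Finset ι) (f : ∀ i : s, Dens e (O i)),
      x = ∑ i : s, DirectSum.lof ℂ ι (fun i => Dens e (O i)) i (f i) ∧
        ∀ y, total e O x y = ∑ i : s, (f i).coeff y := by
  classical
  have hx : x = ∑ i : DFinsupp.support x,
      DirectSum.lof ℂ ι (fun i => Dens e (O i)) i (x i) := by
    conv_lhs => rw [← DirectSum.sum_support_of x]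
    exact (Finset.sum_coe_sort (DFinsupp.support x)
      (fun i => DirectSum.lof ℂ ι (fun i => Dens e (O i)) i (x i))).symm
  refine ⟨DFinsupp.support x, fun i => x i, hx, fun y => ?_⟩
  conv_lhs => rw [hx]
  rw [map_sum, Finset.sum_apply]
  exact Finset.sum_congr rfl fun i _ => congrFun (total_lof _ _) y

/-! ### Constructing relations -/

section Relations

variable {ι F Y Z : Type} [DecidableEq ι] [NormedAddCommGroup F] [NormedSpace ℝ F]

/-- The elements that span the relations, with an arbitrary finite index type. -/
theorem sum_lof_mem_relations [TopologicalSpace Y] [MeasureSpace Y]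
    {e : F → Y} {ρ : Y → Z}
    {adm : ∀ k : ℕ, Set (Fin k → ℝ) → ((Fin k → ℝ) → Z) → Prop} {O : ι → Set Y}
    {A : Type} [Fintype A] {k : ℕ} {V : Set (Fin k → ℝ)}
    {χ : (Fin k → ℝ) → Z} (hV : adm k V χ) (n : A → ℕ) (W : ∀ a, Set (Fin (n a) → ℝ))
    (idx : A → ι) (p : ∀ a, (Fin (n a) → ℝ) → Y) (q : ∀ a, (Fin (n a) → ℝ) → (Fin k → ℝ))
    (f : ∀ a, Dens (id : (Fin (n a) → ℝ) → (Fin (n a) → ℝ)) (W a))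
    (g : ∀ a, Dens e (O (idx a)))
    (hW : ∀ a, IsOpen (W a) ∧
        IsSubmersionOn e (W a) (p a) ∧ MapsTo (p a) (W a) (O (idx a)) ∧
        IsSubmersionOn id (W a) (q a) ∧ MapsTo (q a) (W a) V ∧
        ∀ y ∈ W a, ρ (p a y) = χ (q a y))
    (hzero : ∀ u : C(Fin k → ℝ, ℂ), ∑ a, ∫ y, (f a).coeff y * u (q a y) = 0)
    (hfib : ∀ a, IsFiberIntegral (p a) (f a).coeff (g a).coeff) :
    ∑ a, DirectSum.lof ℂ ι (fun i => Dens e (O i)) (idx a) (g a) ∈ relations e ρ adm O := by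
  let E := (Fintype.equivFin A).symm
  refine Submodule.subset_span ⟨k, V, χ, Fintype.card A, fun a => n (E a), fun a => W (E a),
    fun a => idx (E a), fun a => p (E a), fun a => q (E a), fun a => f (E a), fun a => g (E a),
    hV, fun a => hW _, fun u => ?_, fun a => hfib _, ?_⟩
  · rw [← hzero u]
    exact E.sum_comp fun a => ∫ y, (f a).coeff y * u (q a y)
  · exact (E.sum_comp fun a => DirectSum.lof ℂ ι (fun i => Dens e (O i)) (idx a) (g a)).symm

variable [MeasureSpace F] [BorelSpace F] [IsFiniteMeasureOnCompacts (volume : Measure F)]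
  [AddCommGroup Y] [TopologicalSpace Y]
  [SecondCountableTopology Y] [MeasureSpace Y] [BorelSpace Y]
  {e : F → Y} {θ : F → ℝ} {ρ : Y → Z}
  {adm : ∀ k : ℕ, Set (Fin k → ℝ) → ((Fin k → ℝ) → Z) → Prop} {O : ι → Set Y}

/-- An element whose components add up to `0` is a relation. -/
theorem IsUnfolding.mem_relations_of_total_eq_zero (h : IsUnfolding e θ) (hO : ∀ i, IsOpen (O i))
    {d : ℕ} (L : (Fin d → ℝ) ≃L[ℝ] F) (hL : MeasurePreserving L)
    (hadm : adm d univ (ρ ∘ e ∘ L)) {x : ⨁ i, Dens e (O i)} (hx : total e O x = 0) :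
    x ∈ relations e ρ adm O := by
  obtain ⟨s, c, hxc, hc⟩ := exists_finset_eq_sum_lof x
  have hf : ∀ i : s, (fun y => (θ (L y) : ℂ) * (c i).coeff (e (L y))) ∈
      densities (id : (Fin d → ℝ) → (Fin d → ℝ)) ((e ∘ L) ⁻¹' O i) := fun i => by
    have hm := h.weight_mul_mem (c i).coeff_mem
    refine ⟨hm.1.comp L.contDiff, hm.2.1.comp_homeomorph L.toHomeomorph, ?_⟩
    exact (tsupport_comp_subset_preimage _ L.continuous).trans (preimage_mono hm.2.2)
  have hcont : Continuous (e ∘ L) := h.continuous.comp L.continuous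
  have hsum : ∀ y, ∑ i : s, (c i).coeff y = 0 := fun y => by rw [← hc, hx, Pi.zero_apply]
  rw [hxc]
  -- Each `p` is the covering, `q` the identity, `χ = ρ ∘ e`, and the densities are the lifts `θ ·
  -- (c i ∘ e)`. They add up to zero because the `c i` do, and push forward to `c i` because `θ` has
  -- fibre integrals one.
  refine sum_lof_mem_relations hadm (fun _ => d) (fun i : s => (e ∘ L) ⁻¹' O i) (fun i => i.1)
    (fun _ => e ∘ L) (fun _ => id) (fun i => Dens.mk _ (hf i)) c
    (fun i => ⟨(hO _).preimage hcont, isSubmersionOn_equiv _ L, fun _ hy => hy,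
      isSubmersionOn_id _, mapsTo_univ _ _, fun _ _ => rfl⟩) (fun u => ?_) fun i u => ?_
  · rw [← integral_finsetSum]
    · simp only [Dens.coeff_mk, id]
      simp_rw [← Finset.sum_mul, ← Finset.mul_sum, hsum]
      simp
    · intro i _
      exact Dens.integrable_mul_comp (Dens.mk _ (hf i)) ((hO _).preimage hcont)
        continuousOn_id u.continuous
  · simp only [Dens.coeff_mk, Function.comp_apply]
    rw [hL.integral_comp L.toHomeomorph.measurableEmbedding
      fun v => (θ v : ℂ) * (c i).coeff (e v) * u (e v)]
    simp only [mul_assoc]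
    exact h.integral_comp (f := fun y => (c i).coeff y * u y)
      ((h.continuous_of_mem (c i).coeff_mem).mul u.continuous).aestronglyMeasurable

/-- A family as in the definition of the relations, except that the fibre integrals are not
supported in members of the cover, yields a relation. -/
theorem IsUnfolding.mem_relations_of_total_eq_sum [CompactSpace Y] (h : IsUnfolding e θ)
    (hO : ∀ i, IsOpen (O i)) (hcover : ⋃ i, O i = univ)
    (hker : ∀ x, total e O x = 0 → x ∈ relations e ρ adm O)
    {A : Type} [Fintype A] {k : ℕ} {V : Set (Fin k → ℝ)}
    {χ : (Fin k → ℝ) → Z} (hV : adm k V χ) (n : A → ℕ) (W : ∀ a, Set (Fin (n a) → ℝ))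
    (p : ∀ a, (Fin (n a) → ℝ) → Y) (q : ∀ a, (Fin (n a) → ℝ) → (Fin k → ℝ))
    (f : ∀ a, Dens (id : (Fin (n a) → ℝ) → (Fin (n a) → ℝ)) (W a))
    (g : A → Y → ℂ) (hg : ∀ a, g a ∈ densities e univ)
    (hW : ∀ a, IsOpen (W a) ∧ IsSubmersionOn e (W a) (p a) ∧
        IsSubmersionOn id (W a) (q a) ∧ MapsTo (q a) (W a) V ∧
        ∀ y ∈ W a, ρ (p a y) = χ (q a y))
    (hzero : ∀ u : C(Fin k → ℝ, ℂ), ∑ a, ∫ y, (f a).coeff y * u (q a y) = 0)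
    (hfib : ∀ a, IsFiberIntegral (p a) (f a).coeff (g a))
    {x : ⨁ i, Dens e (O i)} (hx : total e O x = ∑ a, g a) : x ∈ relations e ρ adm O := by
  -- As `Y` is compact, the constant `1` is itself a density, and splitting it along the cover is a
  -- partition of unity.
  obtain ⟨φ, hφ⟩ : ∃ φ, total e O φ = 1 := h.exists_total_eq hO hcover
    ⟨contDiff_const, HasCompactSupport.of_compactSpace _, subset_univ _⟩
  obtain ⟨s, c, -, hc⟩ := exists_finset_eq_sum_lof φ
  have hsum : ∀ y, ∑ i : s, (c i).coeff y = 1 := fun y => by rw [← hc, hφ, Pi.one_apply]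
  have hgφ : ∀ a (i : s), (fun y => g a y * (c i).coeff y) ∈ densities e (O i) := fun a (i : s) =>
    ⟨(hg a).1.mul (c i).coeff_mem.1, (hg a).2.1.mul_right,
      (tsupport_mul_subset_right).trans (c i).coeff_mem.2.2⟩
  have hpc : ∀ a, ContinuousOn (p a) (W a) := fun a => (hW a).2.1.continuousOn h.continuous
  have hqc : ∀ a, ContinuousOn (q a) (W a) := fun a => (hW a).2.2.1.continuousOn continuous_id
  have hopen : ∀ a (i : s), IsOpen (W a ∩ p a ⁻¹' O i) := fun a (i : s) =>
    (hpc a).isOpen_inter_preimage (hW a).1 (hO i)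
  have hfφ : ∀ a (i : s), (fun y => (f a).coeff y * (c i).coeff (p a y)) ∈
      densities (id : (Fin (n a) → ℝ) → (Fin (n a) → ℝ)) (W a ∩ p a ⁻¹' O i) := fun a (i : s) =>
    mul_comp_mem_densities h.continuous (f a).coeff_mem (hW a).2.1 (c i).coeff_mem
  have key := sum_lof_mem_relations (e := e) (ρ := ρ) (O := O) (A := A × s) hV
    (fun b => n b.1)
    (fun b => W b.1 ∩ p b.1 ⁻¹' O b.2.1) (fun b => b.2.1) (fun b => p b.1) (fun b => q b.1)
    (fun b => Dens.mk _ (hfφ b.1 b.2)) (fun b => Dens.mk _ (hgφ b.1 b.2))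
    (fun b => ⟨hopen _ _, (hW b.1).2.1.mono inter_subset_left, fun y hy => hy.2,
      (hW b.1).2.2.1.mono inter_subset_left, (hW b.1).2.2.2.1.mono_left inter_subset_left,
      fun y hy => (hW b.1).2.2.2.2 y hy.1⟩) (fun u => ?_) fun b u => ?_
  · rw [← sub_add_cancel x (∑ b : A × s,
      DirectSum.lof ℂ ι (fun i => Dens e (O i)) b.2.1 (Dens.mk _ (hgφ b.1 b.2)))]
    refine add_mem (hker _ ?_) key
    rw [_root_.map_sub, hx, map_sum, sub_eq_zero]
    simp only [total_lof, Dens.coeff_mk, Fintype.sum_prod_type]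
    refine Finset.sum_congr rfl fun a _ => ?_
    funext y
    rw [Finset.sum_apply, ← Finset.mul_sum, hsum, mul_one]
  · rw [← hzero u, Fintype.sum_prod_type]
    refine Finset.sum_congr rfl fun a _ => ?_
    have hint : ∀ i ∈ (Finset.univ : Finset s), Integrable fun y =>
        (f a).coeff y * (c i).coeff (p a y) * u (q a y) := fun i _ =>
      Dens.integrable_mul_comp (Dens.mk (e := id) _ (hfφ a i)) (hopen a i)
        ((hqc a).mono inter_subset_left) u.continuous
    refine (integral_finsetSum _ hint).symm.trans ?_
    refine integral_congr_ae (ae_of_all _ fun y => ?_)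
    simp only
    rw [← Finset.sum_mul, ← Finset.mul_sum, hsum, mul_one]
  -- Multiplying `f` by `c ∘ p` multiplies its push-forward by `c`: use `c · u` as the test
  -- function.
  · have := hfib b.1 ⟨fun y => (c b.2).coeff y * u y,
      (h.continuous_of_mem (c b.2).coeff_mem).mul u.continuous⟩
    simpa only [Dens.coeff_mk, mul_assoc, ContinuousMap.coe_mk] using this

end Relations

/-- Splitting off the first `d` of `d + n` coordinates. -/
def splitEquiv {F : Type} [NormedAddCommGroup F] [NormedSpace ℝ F] {d : ℕ}
    (L : (Fin d → ℝ) ≃L[ℝ] F) (n : ℕ) : (Fin (d + n) → ℝ) ≃L[ℝ] F × (Fin n → ℝ) :=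
  ((LinearEquiv.funCongrLeft ℝ ℝ finSumFinEquiv).trans
    (LinearEquiv.sumArrowLequivProdArrow (Fin d) (Fin n) ℝ ℝ)).toContinuousLinearEquiv.trans
    (L.prodCongr (ContinuousLinearEquiv.refl ℝ _))

theorem measurePreserving_splitEquiv {F : Type} [NormedAddCommGroup F] [NormedSpace ℝ F]
    [MeasureSpace F] [BorelSpace F] [SFinite (volume : Measure F)] {d : ℕ} {L : (Fin d → ℝ) ≃L[ℝ] F}
    (hL : MeasurePreserving L) (n : ℕ) : MeasurePreserving (splitEquiv L n) := by
  have h1 := (volume_measurePreserving_sumPiEquivProdPi (fun _ : Fin d ⊕ Fin n => ℝ)).comp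
    (volume_measurePreserving_piCongrLeft (fun _ : Fin d ⊕ Fin n => ℝ) finSumFinEquiv.symm)
  have h2 := (hL.prod (MeasurePreserving.id (volume : Measure (Fin n → ℝ)))).comp h1
  have h3 : ⇑(splitEquiv L n) = Prod.map L id ∘
      (MeasurableEquiv.sumPiEquivProdPi fun _ : Fin d ⊕ Fin n => ℝ) ∘
      (MeasurableEquiv.piCongrLeft (fun _ : Fin d ⊕ Fin n => ℝ) finSumFinEquiv.symm) := by
    have : ∀ (w : Fin (d + n) → ℝ) (i : Fin d ⊕ Fin n), MeasurableEquiv.piCongrLeft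
        (fun _ : Fin d ⊕ Fin n => ℝ) finSumFinEquiv.symm w i = w (finSumFinEquiv i) :=
      fun w i => by
        obtain ⟨j, rfl⟩ := (finSumFinEquiv (m := d) (n := n)).symm.surjective i
        rw [Equiv.apply_symm_apply]
        exact Equiv.piCongrLeft_apply_apply (fun _ : Fin d ⊕ Fin n => ℝ) _ _ _
    funext w
    refine Prod.ext (congrArg L (funext fun i => ?_)) (funext fun j => ?_)
    · exact (this w (Sum.inl i)).symm
    · exact (this w (Sum.inr j)).symm
  rw [h3]
  exact h2

/-! ### The torus relations are stable under involution and convolution -/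

section Closure

/-- `total` as a map to the space of all compactly supported smooth densities. -/
def totalDens {F Y : Type} [NormedAddCommGroup F] [NormedSpace ℝ F] [TopologicalSpace Y]
    (e : F → Y) {ι : Type} [DecidableEq ι] (O : ι → Set Y) :
    (⨁ i, Dens e (O i)) →ₗ[ℂ] densities e univ :=
  (total e O).codRestrict _ total_mem

@[simp] theorem coe_totalDens {F Y : Type} [NormedAddCommGroup F] [NormedSpace ℝ F]
    [TopologicalSpace Y] (e : F → Y) {ι : Type} [DecidableEq ι] (O : ι → Set Y)
    (x : ⨁ i, Dens e (O i)) : (totalDens e O x : Y → ℂ) = total e O x := rfl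

/-- The coordinates of `ℝ²`. -/
def planeEquiv : (Fin 2 → ℝ) ≃L[ℝ] ℝ × ℝ := ContinuousLinearEquiv.finTwoArrow ℝ ℝ

theorem measurePreserving_planeEquiv : MeasurePreserving planeEquiv :=
  volume_preserving_finTwoArrow ℝ

/-- The coordinates of `ℝ² × ℝ`. -/
def spaceEquiv : (Fin (2 + 1) → ℝ) ≃L[ℝ] (ℝ × ℝ) × ℝ :=
  (splitEquiv planeEquiv 1).trans
    ((ContinuousLinearEquiv.refl ℝ (ℝ × ℝ)).prodCongr (ContinuousLinearEquiv.funUnique (Fin 1) ℝ ℝ))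

theorem measurePreserving_spaceEquiv : MeasurePreserving spaceEquiv :=
  ((MeasurePreserving.id volume).prod (volume_preserving_funUnique (Fin 1) ℝ)).comp
    (measurePreserving_splitEquiv measurePreserving_planeEquiv 1)

variable {ι : Type} [DecidableEq ι] (lam : ℝ) {O : ι → Set Torus}

theorem mem_torus_relations_of_total_eq_zero (hO : ∀ i, IsOpen (O i))
    {x : ⨁ i, Dens torusMk (O i)} (hx : total torusMk O x = 0) :
    x ∈ relations torusMk (proj lam) (fun _ V χ => IsPlot lam V χ) O :=
  isUnfolding_torus.mem_relations_of_total_eq_zero hO planeEquiv measurePreserving_planeEquiv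
    ⟨isOpen_univ, fun _ _ => ⟨planeEquiv, Eventually.of_forall fun _ =>
      ⟨planeEquiv.contDiff.contDiffAt, rfl⟩⟩⟩ hx

theorem torusMk_add (v w : ℝ × ℝ) : torusMk (v + w) = torusMk v + torusMk w :=
  isUnfolding_torus.map_add v w

theorem torusMk_neg (v : ℝ × ℝ) : torusMk (-v) = -torusMk v :=
  isUnfolding_torus.map_neg v

theorem integral_neg_torus (f : Torus → ℂ) : ∫ y, f (-y) = ∫ y, f y :=
  haveI := Measure.IsAddHaarMeasure.isNegInvariant_of_regular (volume : Measure Torus)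
  integral_neg_eq_self f volume

theorem IsPlot.neg {k : ℕ} {V : Set (Fin k → ℝ)} {χ : (Fin k → ℝ) → LeafGroup lam}
    (h : IsPlot lam V χ) : IsPlot lam V (fun y => -χ y) :=
  ⟨h.1, fun x hx => by
    obtain ⟨P, hP⟩ := h.2 x hx
    exact ⟨fun y => -P y, hP.mono fun y hy =>
      ⟨hy.1.neg, by simp only [hy.2, torusMk_neg, map_neg]⟩⟩⟩

theorem IsSubmersionOn.neg {n : ℕ} {W : Set (Fin n → ℝ)} {p : (Fin n → ℝ) → Torus}
    (h : IsSubmersionOn torusMk W p) : IsSubmersionOn torusMk W (fun y => -p y) := fun x hx => by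
  obtain ⟨P, hP, hs⟩ := h x hx
  refine ⟨fun y => -P y, hP.mono fun y hy => ⟨hy.1.neg, by simp only [hy.2, torusMk_neg]⟩, fun w => ?_⟩
  obtain ⟨v, hv⟩ := hs (-w)
  exact ⟨v, by rw [fderiv_fun_neg, neg_apply, hv, neg_neg]⟩

/-- The involution preserves the relations of `C_c^∞(G)`. -/
theorem mem_torus_relations_of_total_eq_involution (hO : ∀ i, IsOpen (O i))
    (hcover : ⋃ i, O i = univ) {r x : ⨁ i, Dens torusMk (O i)}
    (hr : r ∈ relations torusMk (proj lam) (fun _ V χ => IsPlot lam V χ) O)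
    (hx : total torusMk O x = involution (total torusMk O r)) :
    x ∈ relations torusMk (proj lam) (fun _ V χ => IsPlot lam V χ) O := by
  let R := relations torusMk (proj lam) (fun _ V χ => IsPlot lam V χ) O
  have hker : ∀ x, total torusMk O x = 0 → x ∈ R := fun x hx =>
    mem_torus_relations_of_total_eq_zero lam hO hx
  -- Stated as an inclusion of subspaces, the claim need only be checked on the spanning elements.
  -- By `hker` it does not matter which preimage under `total` is taken.
  have hle : R ≤ (R.map (totalDens torusMk O)).comap
      (isUnfolding_torus.starAlg.star.comp (totalDens torusMk O)) := by
    refine Submodule.span_le.2 ?_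
    rintro _ ⟨k, V, χ, N, n, W, idx, p, q, f, g, hV, hW, hzero, hfib, rfl⟩
    obtain ⟨x, hx⟩ := isUnfolding_torus.exists_total_eq hO hcover (isUnfolding_torus.involution_mem
      (total_mem (∑ a, DirectSum.lof ℂ ι (fun i => Dens torusMk (O i)) (idx a) (g a))))
    refine ⟨x, ?_, Subtype.ext hx⟩
    have hf : ∀ a, (fun y => starRingEnd ℂ ((f a).coeff y)) ∈
        densities (id : (Fin (n a) → ℝ) → (Fin (n a) → ℝ)) (W a) := fun a =>
      ⟨Complex.conjCLE.contDiff.comp (f a).coeff_mem.1,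
        (f a).coeff_mem.2.1.comp_left (map_zero (starRingEnd ℂ)),
        (closure_mono (Function.support_comp_subset (map_zero (starRingEnd ℂ)) _)).trans
          (f a).coeff_mem.2.2⟩
    refine isUnfolding_torus.mem_relations_of_total_eq_sum hO hcover hker (IsPlot.neg lam hV) n W
      (fun a y => -p a y) q (fun a => Dens.mk _ (hf a)) (fun a => involution (g a).coeff)
      (fun a => isUnfolding_torus.involution_mem
        (densities_mono (subset_univ _) (g a).coeff_mem))
      (fun a => ⟨(hW a).1, (hW a).2.1.neg, (hW a).2.2.2.1, (hW a).2.2.2.2.1, fun y hy => by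
        rw [map_neg, (hW a).2.2.2.2.2 y hy]⟩) (fun u => ?_) (fun a u => ?_) ?_
    -- Conjugate the vanishing condition for the test function `conj u`.
    · have h1 := congrArg (starRingEnd ℂ)
        (hzero ⟨fun y => starRingEnd ℂ (u y), Complex.continuous_conj.comp u.continuous⟩)
      rw [map_sum, map_zero] at h1
      rw [← h1]
      refine Finset.sum_congr rfl fun a _ => ?_
      rw [← integral_conj]
      simp
    · have h1 := congrArg (starRingEnd ℂ)
        (hfib a ⟨fun y => starRingEnd ℂ (u (-y)),
          Complex.continuous_conj.comp (u.continuous.comp continuous_neg)⟩)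
      rw [← integral_conj, ← integral_conj] at h1
      simp only [ContinuousMap.coe_mk, map_mul, Complex.conj_conj] at h1
      simp only [Dens.coeff_mk]
      rw [h1, ← integral_neg_torus fun y : Torus => starRingEnd ℂ ((g a).coeff y) * u (-y)]
      simp only [involution, neg_neg]
    · rw [hx, map_sum]
      funext y
      simp [involution, total_lof]
  obtain ⟨y, hy, hyx⟩ := hle hr
  rw [← sub_add_cancel x y]
  refine add_mem (hker _ ?_) hy
  rw [map_sub, hx, sub_eq_zero]
  exact (congrArg Subtype.val hyx).symm

theorem IsPlot.add_torusMk {k : ℕ} {V : Set (Fin k → ℝ)} {χ : (Fin k → ℝ) → LeafGroup lam}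
    (h : IsPlot lam V χ) : IsPlot lam (splitEquiv planeEquiv k ⁻¹' (univ ×ˢ V))
      (fun z => proj lam (torusMk (splitEquiv planeEquiv k z).1) +
        χ (splitEquiv planeEquiv k z).2) := by
  have hc : ContDiff ℝ ∞ (splitEquiv planeEquiv k) := (splitEquiv planeEquiv k).contDiff
  refine ⟨(isOpen_univ.prod h.1).preimage hc.continuous, fun z hz => ?_⟩
  obtain ⟨P, hP⟩ := h.2 _ hz.2
  have ht : Tendsto (fun z => (splitEquiv planeEquiv k z).2) (𝓝 z)
      (𝓝 (splitEquiv planeEquiv k z).2) :=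
    (continuous_snd.comp hc.continuous).continuousAt
  refine ⟨fun z => (splitEquiv planeEquiv k z).1 + P (splitEquiv planeEquiv k z).2,
    (ht.eventually hP).mono fun w hw => ⟨?_, ?_⟩⟩
  · exact (contDiff_fst.comp hc).contDiffAt.add
      (hw.1.comp w (contDiff_snd.comp hc).contDiffAt)
  · simp only [hw.2, torusMk_add, map_add]

/-- The differential is already onto along the added translation variable. -/
theorem IsSubmersionOn.add_torusMk {n : ℕ} {W : Set (Fin n → ℝ)} {p : (Fin n → ℝ) → Torus}
    (h : IsSubmersionOn torusMk W p) :
    IsSubmersionOn torusMk (splitEquiv planeEquiv n ⁻¹' (univ ×ˢ W))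
      (fun z => torusMk (splitEquiv planeEquiv n z).1 + p (splitEquiv planeEquiv n z).2) := by
  intro z hz
  let M := splitEquiv planeEquiv n
  have hc : ContDiff ℝ ∞ M := M.contDiff
  obtain ⟨P, hP, -⟩ := h _ hz.2
  have ht : Tendsto (fun z => (M z).2) (𝓝 z) (𝓝 (M z).2) :=
    (continuous_snd.comp hc.continuous).continuousAt
  refine ⟨fun z => (M z).1 + P (M z).2, (ht.eventually hP).mono fun w hw => ⟨?_, ?_⟩, fun w => ?_⟩
  · exact (contDiff_fst.comp hc).contDiffAt.add (hw.1.comp w (contDiff_snd.comp hc).contDiffAt)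
  · simp only [M, hw.2, torusMk_add]
  · have hP' : HasFDerivAt P (fderiv ℝ P (M z).2) (M z).2 :=
      (hP.self_of_nhds.1.differentiableAt (by simp)).hasFDerivAt
    have hM : HasFDerivAt M (M : (Fin (2 + n) → ℝ) →L[ℝ] (ℝ × ℝ) × (Fin n → ℝ)) z := M.hasFDerivAt
    have hd := hM.fst.add (hP'.comp z hM.snd)
    have hd' : fderiv ℝ (fun z => (M z).1 + P (M z).2) z = _ := hd.fderiv
    refine ⟨M.symm (w, 0), ?_⟩
    rw [hd']
    simp

/-- In the split coordinates the differential is the direct sum of the identity of `ℝ²` and the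
differential of `q`. -/
theorem IsSubmersionOn.prod_id {n k : ℕ} {W : Set (Fin n → ℝ)} {q : (Fin n → ℝ) → (Fin k → ℝ)}
    (h : IsSubmersionOn id W q) :
    IsSubmersionOn id (splitEquiv planeEquiv n ⁻¹' (univ ×ˢ W))
      (fun z => (splitEquiv planeEquiv k).symm
        ((splitEquiv planeEquiv n z).1, q (splitEquiv planeEquiv n z).2)) := by
  intro z hz
  let M := splitEquiv planeEquiv n
  let M' := splitEquiv planeEquiv k
  have hc : ContDiff ℝ ∞ M := M.contDiff
  obtain ⟨P, hP, hs⟩ := h _ hz.2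
  have ht : Tendsto (fun z => (M z).2) (𝓝 z) (𝓝 (M z).2) :=
    (continuous_snd.comp hc.continuous).continuousAt
  refine ⟨fun z => M'.symm ((M z).1, P (M z).2),
    (ht.eventually hP).mono fun w hw => ⟨?_, ?_⟩, fun w => ?_⟩
  · exact M'.symm.contDiff.contDiffAt.comp w ((contDiff_fst.comp hc).contDiffAt.prodMk
      (hw.1.comp w (contDiff_snd.comp hc).contDiffAt))
  · simp only [hw.2, id, M, M']
  · have hP' : HasFDerivAt P (fderiv ℝ P (M z).2) (M z).2 :=
      (hP.self_of_nhds.1.differentiableAt (by simp)).hasFDerivAt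
    have hM : HasFDerivAt M (M : (Fin (2 + n) → ℝ) →L[ℝ] (ℝ × ℝ) × (Fin n → ℝ)) z := M.hasFDerivAt
    have hd := (M'.symm.hasFDerivAt (x := ((M z).1, P (M z).2))).comp z
      (hM.fst.prodMk (hP'.comp z hM.snd))
    have hd' : fderiv ℝ (fun z => M'.symm ((M z).1, P (M z).2)) z = _ := hd.fderiv
    obtain ⟨v, hv⟩ := hs (M' w).2
    refine ⟨M.symm ((M' w).1, v), ?_⟩
    rw [hd']
    have hv' : fderiv ℝ P (M z).2 v = (M' w).2 := hv
    simp [hv']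

theorem tensor_mem_densities {n : ℕ} {W : Set (Fin n → ℝ)} {β : ℝ × ℝ → ℂ}
    (hβ : β ∈ densities id univ) {f : (Fin n → ℝ) → ℂ} (hf : f ∈ densities id W) :
    (fun z => β (splitEquiv planeEquiv n z).1 * f (splitEquiv planeEquiv n z).2) ∈
      densities (id : (Fin (2 + n) → ℝ) → (Fin (2 + n) → ℝ))
        (splitEquiv planeEquiv n ⁻¹' (univ ×ˢ W)) := by
  let M := splitEquiv planeEquiv n
  have hc : ContDiff ℝ ∞ M := M.contDiff
  have hsub : tsupport (fun z => β (M z).1 * f (M z).2) ⊆ M ⁻¹' (tsupport β ×ˢ tsupport f) := by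
    refine closure_minimal (fun z hz => ?_)
      (((isClosed_tsupport β).prod (isClosed_tsupport f)).preimage hc.continuous)
    exact ⟨subset_tsupport _ (left_ne_zero_of_mul hz), subset_tsupport _ (right_ne_zero_of_mul hz)⟩
  refine ⟨?_, ?_, hsub.trans (preimage_mono (prod_mono (subset_univ _) hf.2.2))⟩
  · exact (hβ.1.comp (contDiff_fst.comp hc)).mul (hf.1.comp (contDiff_snd.comp hc))
  · exact (M.toHomeomorph.isCompact_preimage.2 (IsCompact.prod hβ.2.1 hf.2.1)).of_isClosed_subset
      (isClosed_tsupport _) hsub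

/-- The integral of a tensor product over `ℝ² × ℝ^n` as an iterated integral. -/
theorem integral_tensor_mul {n : ℕ} {W : Set (Fin n → ℝ)} (hW : IsOpen W) {β : ℝ × ℝ → ℂ}
    (hβ : β ∈ densities id univ) {f : (Fin n → ℝ) → ℂ} (hf : f ∈ densities id W)
    {H : (ℝ × ℝ) × (Fin n → ℝ) → ℂ} (hH : ContinuousOn H (univ ×ˢ W)) :
    Integrable (fun v => ∫ w, β v * f w * H (v, w)) ∧
    ∫ z, β (splitEquiv planeEquiv n z).1 * f (splitEquiv planeEquiv n z).2 *
      H (splitEquiv planeEquiv n z) = ∫ v, ∫ w, β v * f w * H (v, w) := by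
  have hsub : tsupport (fun z : (ℝ × ℝ) × (Fin n → ℝ) => β z.1 * f z.2) ⊆
      tsupport β ×ˢ tsupport f := by
    refine closure_minimal (fun z hz => ?_) ((isClosed_tsupport β).prod (isClosed_tsupport f))
    exact ⟨subset_tsupport _ (left_ne_zero_of_mul hz), subset_tsupport _ (right_ne_zero_of_mul hz)⟩
  have hint : Integrable fun z : (ℝ × ℝ) × (Fin n → ℝ) => β z.1 * f z.2 * H z :=
    integrable_mul_of_tsupport_subset
      ((hβ.1.continuous.comp continuous_fst).mul (hf.1.continuous.comp continuous_snd))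
      ((IsCompact.prod hβ.2.1 hf.2.1).of_isClosed_subset (isClosed_tsupport _) hsub)
      (isOpen_univ.prod hW) (hsub.trans (prod_mono (subset_univ _) hf.2.2)) hH
  refine ⟨hint.integral_prod_left, ?_⟩
  rw [(measurePreserving_splitEquiv measurePreserving_planeEquiv n).integral_comp
    (splitEquiv planeEquiv n).toHomeomorph.measurableEmbedding
    fun z : (ℝ × ℝ) × (Fin n → ℝ) => β z.1 * f z.2 * H z]
  exact integral_prod _ hint

/-- The relations of `C_c^∞(G)` form an ideal for the convolution. -/
theorem mem_torus_relations_of_total_eq_conv (hO : ∀ i, IsOpen (O i))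
    (hcover : ⋃ i, O i = univ) {b : Torus → ℂ} (hb : b ∈ densities torusMk univ)
    {r x : ⨁ i, Dens torusMk (O i)}
    (hr : r ∈ relations torusMk (proj lam) (fun _ V χ => IsPlot lam V χ) O)
    (hx : total torusMk O x = conv b (total torusMk O r)) :
    x ∈ relations torusMk (proj lam) (fun _ V χ => IsPlot lam V χ) O := by
  let R := relations torusMk (proj lam) (fun _ V χ => IsPlot lam V χ) O
  have hker : ∀ x, total torusMk O x = 0 → x ∈ R := fun x hx =>
    mem_torus_relations_of_total_eq_zero lam hO hx
  have hU := isUnfolding_torus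
  have hle : R ≤ (R.map (totalDens torusMk O)).comap
      ((hU.starAlg.mul ⟨b, hb⟩).comp (totalDens torusMk O)) := by
    refine Submodule.span_le.2 ?_
    rintro _ ⟨k, V, χ, N, n, W, idx, p, q, f, g, hV, hW, hzero, hfib, rfl⟩
    obtain ⟨x, hx⟩ := hU.exists_total_eq hO hcover (hU.conv_mem hb
      (total_mem (∑ a, DirectSum.lof ℂ ι (fun i => Dens torusMk (O i)) (idx a) (g a))))
    refine ⟨x, ?_, Subtype.ext hx⟩
    have hg : ∀ a, (g a).coeff ∈ densities torusMk univ := fun a =>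
      densities_mono (subset_univ _) (g a).coeff_mem
    -- Relations use open subsets of Euclidean space, so the torus variable of the convolution is
    -- unfolded to `ℝ²`, with `b` replaced by its weighted lift.
    have hβ : (fun v => (torusWeight v : ℂ) * b (torusMk v)) ∈
        densities (id : ℝ × ℝ → ℝ × ℝ) univ := hU.weight_mul_mem hb
    have hpc : ∀ a, ContinuousOn (p a) (W a) := fun a => (hW a).2.1.continuousOn hU.continuous
    have hqc : ∀ a, ContinuousOn (q a) (W a) := fun a =>
      (hW a).2.2.2.1.continuousOn continuous_id
    have hsnd : ∀ a, MapsTo Prod.snd (univ ×ˢ W a : Set ((ℝ × ℝ) × (Fin (n a) → ℝ))) (W a) :=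
      fun a z hz => hz.2
    refine hU.mem_relations_of_total_eq_sum hO hcover hker (IsPlot.add_torusMk lam hV)
      (fun a => 2 + n a) (fun a => splitEquiv planeEquiv (n a) ⁻¹' (univ ×ˢ W a))
      (fun a z => torusMk (splitEquiv planeEquiv (n a) z).1 +
        p a (splitEquiv planeEquiv (n a) z).2)
      (fun a z => (splitEquiv planeEquiv k).symm ((splitEquiv planeEquiv (n a) z).1,
        q a (splitEquiv planeEquiv (n a) z).2))
      (fun a => Dens.mk _ (tensor_mem_densities hβ (f a).coeff_mem))
      (fun a => conv b (g a).coeff) (fun a => hU.conv_mem hb (hg a))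
      (fun a => ⟨(isOpen_univ.prod (hW a).1).preimage (splitEquiv planeEquiv (n a)).continuous,
        (hW a).2.1.add_torusMk, (hW a).2.2.2.1.prod_id, fun z hz => ?_, fun z hz => ?_⟩)
      (fun u => ?_) (fun a u => ?_) ?_
    · simpa using (hW a).2.2.2.2.1 hz.2
    · simp only [map_add, (hW a).2.2.2.2.2 _ hz.2, ContinuousLinearEquiv.apply_symm_apply]
    · have hH : ∀ a, ContinuousOn (fun z : (ℝ × ℝ) × (Fin (n a) → ℝ) =>
          u ((splitEquiv planeEquiv k).symm (z.1, q a z.2))) (univ ×ˢ W a) := fun a =>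
        (u.continuous.comp (splitEquiv planeEquiv k).symm.continuous).comp_continuousOn
          (continuousOn_fst.prodMk ((hqc a).comp continuousOn_snd (hsnd a)))
      have hI := fun a => integral_tensor_mul (hW a).1 hβ (f a).coeff_mem (hH a)
      refine (Finset.sum_congr rfl fun a _ => (hI a).2).trans ?_
      rw [← integral_finsetSum _ fun a _ => (hI a).1]
      -- For fixed `v` the inner integrals add up to `β v` times the original condition `q_! f = 0`,
      -- tested on `u` restricted to the slice at `v`.
      refine integral_eq_zero_of_ae (ae_of_all _ fun v => ?_)
      have hz := hzero ⟨fun y => u ((splitEquiv planeEquiv k).symm (v, y)),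
        u.continuous.comp ((splitEquiv planeEquiv k).symm.continuous.comp
          (continuous_const.prodMk continuous_id))⟩
      simp only [ContinuousMap.coe_mk] at hz
      simp only [mul_assoc, integral_const_mul, ← Finset.mul_sum, hz, mul_zero, Pi.zero_apply]
    · have hH : ContinuousOn (fun z : (ℝ × ℝ) × (Fin (n a) → ℝ) =>
          u (torusMk z.1 + p a z.2)) (univ ×ˢ W a) :=
        u.continuous.comp_continuousOn ((hU.continuous.comp_continuousOn continuousOn_fst).add
          ((hpc a).comp continuousOn_snd (hsnd a)))
      refine (integral_tensor_mul (hW a).1 hβ (f a).coeff_mem hH).2.trans ?_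
      have hgc := hU.continuous_of_mem (hg a)
      rw [integral_conv_mul (hU.continuous_of_mem hb) hb.2.1 hgc (hg a).2.1,
        ← hU.integral_comp (f := fun x => b x * ∫ y, (g a).coeff y * u (x + y))
          ((hU.continuous_of_mem hb).mul (continuous_integral_mul_comp_add (X := Torus)
            continuous_id hgc (hg a).2.1 u.continuous)).aestronglyMeasurable]
      refine integral_congr_ae (ae_of_all _ fun v => ?_)
      have hf := hfib a (u.comp (ContinuousMap.addLeft (torusMk v)))
      simp only [ContinuousMap.comp_apply, ContinuousMap.coe_addLeft] at hf
      simp only [mul_assoc, integral_const_mul, hf]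
    · rw [hx, map_sum]
      have h1 := congrArg Subtype.val (map_sum (hU.starAlg.mul ⟨b, hb⟩)
        (fun a => (⟨(g a).coeff, hg a⟩ : densities torusMk univ)) Finset.univ)
      simp only [total_lof]
      simpa only [IsUnfolding.coe_starAlg_mul, AddSubmonoidClass.coe_finsetSum] using h1
  obtain ⟨y, hy, hyx⟩ := hle hr
  rw [← sub_add_cancel x y]
  refine add_mem (hker _ ?_) hy
  rw [map_sub, hx, sub_eq_zero]
  exact (congrArg Subtype.val hyx).symm

end Closure

/-! ### The groupoid relations are exactly the elements of total zero -/

section GroupoidRelations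

variable {ι : Type} [DecidableEq ι] {U : ι → Set Groupoid}

theorem mem_groupoid_relations_of_total_eq_zero (hU : ∀ i, IsOpen (U i))
    {x : ⨁ i, Dens groupoidMk (U i)} (hx : total groupoidMk U x = 0) :
    x ∈ relations groupoidMk (id : Groupoid → Groupoid) (fun _ V φ => IsBisubmersion V φ) U :=
  isUnfolding_groupoid.mem_relations_of_total_eq_zero hU spaceEquiv measurePreserving_spaceEquiv
    ⟨isOpen_univ, isSubmersionOn_equiv _ spaceEquiv⟩ hx

/-- Here `ρ` is the identity, so `p = χ ∘ q` and the test function `u ∘ p` factors through `q` as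
`(u ∘ χ) ∘ q`; the condition `q_! f = 0` then annihilates the sum. -/
theorem total_eq_zero_of_mem_groupoid_relations {x : ⨁ i, Dens groupoidMk (U i)}
    (hx : x ∈ relations groupoidMk (id : Groupoid → Groupoid)
      (fun _ V φ => IsBisubmersion V φ) U) : total groupoidMk U x = 0 := by
  suffices h : relations groupoidMk (id : Groupoid → Groupoid)
      (fun _ V φ => IsBisubmersion V φ) U ≤ LinearMap.ker (total groupoidMk U) from h hx
  refine Submodule.span_le.2 ?_
  rintro _ ⟨k, V, χ, N, n, W, idx, p, q, f, g, hV, hW, hzero, hfib, rfl⟩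
  have hg : ∀ a, (g a).coeff ∈ densities groupoidMk univ := fun a =>
    densities_mono (subset_univ _) (g a).coeff_mem
  have hsum := sum_mem (fun a (_ : a ∈ Finset.univ) => hg a)
  simp only [SetLike.mem_coe, LinearMap.mem_ker, map_sum, total_lof]
  refine eq_of_forall_integral_eq (isUnfolding_groupoid.continuous_of_mem hsum) hsum.2.1
    continuous_const HasCompactSupport.zero fun u => ?_
  have hqc : ∀ a, ContinuousOn (q a) (W a) := fun a => (hW a).2.2.2.1.continuousOn continuous_id
  -- The condition on `q_! f` takes test functions on all of `ℝ^k`, while `u ∘ χ` is continuous only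
  -- on `V`. It is extended from the compact set `K ⊆ V` by Tietze's theorem; only its values on `K`
  -- matter.
  let K : Set (Fin k → ℝ) := ⋃ a, q a '' tsupport (f a).coeff
  have hK : IsCompact K := isCompact_iUnion fun a =>
    (f a).coeff_mem.2.1.image_of_continuousOn ((hqc a).mono (f a).coeff_mem.2.2)
  have hKV : K ⊆ V := iUnion_subset fun a =>
    ((hW a).2.2.2.2.1.mono_left (f a).coeff_mem.2.2).image_subset
  have hχ : ContinuousOn (fun y => u (χ y)) K := u.continuous.comp_continuousOn
    ((hV.2.continuousOn isUnfolding_groupoid.continuous).mono hKV)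
  obtain ⟨w, hw⟩ := ContinuousMap.exists_restrict_eq hK.isClosed ⟨_, hχ.domRestrict⟩
  have hw' : ∀ y ∈ K, w y = u (χ y) := fun y hy => DFunLike.congr_fun hw ⟨y, hy⟩
  simp only [Finset.sum_apply, Finset.sum_mul, Pi.zero_apply, zero_mul, integral_zero]
  rw [integral_finsetSum _ fun a _ => integrable_mul_test
    (isUnfolding_groupoid.continuous_of_mem (hg a)) (hg a).2.1 u.continuous, ← hzero w]
  refine Finset.sum_congr rfl fun a _ => ?_
  rw [← hfib a u]
  refine integral_congr_ae (ae_of_all _ fun y => ?_)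
  by_cases hy : y ∈ tsupport (f a).coeff
  · have h1 : p a y = χ (q a y) := (hW a).2.2.2.2.2 y ((f a).coeff_mem.2.2 hy)
    simp only [h1, hw' _ (mem_iUnion.2 ⟨a, mem_image_of_mem _ hy⟩)]
  · simp only [image_eq_zero_of_notMem_tsupport hy, zero_mul]

end GroupoidRelations

/-! ### Descent of a `*`-algebra structure to a quotient -/

section Descent

variable {M A : Type} [AddCommGroup M] [Module ℂ M] [AddCommGroup A] [Module ℂ A]

/-- The `*`-algebra structure of `A` descends along a surjection `t : M → A` to the quotient of `M`
by a subspace that contains the kernel of `t` and is compatible with the structure. -/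
theorem StarAlg.exists_descent (B : StarAlg A) (t : M →ₗ[ℂ] A) (ht : Function.Surjective t)
    (R : Submodule ℂ M) (hker : ∀ x, t x = 0 → x ∈ R)
    (hstar : ∀ r ∈ R, ∀ x, t x = B.star (t r) → x ∈ R)
    (hmul : ∀ r ∈ R, ∀ b x, t x = B.mul b (t r) → x ∈ R) :
    ∃ S : StarAlg (M ⧸ R),
      (∀ a b c, t c = B.mul (t a) (t b) → S.mul (R.mkQ a) (R.mkQ b) = R.mkQ c) ∧
      ∀ a c, t c = B.star (t a) → S.star (R.mkQ a) = R.mkQ c := by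
  -- A linear section makes the operations linear from the start; modulo `R` its choice is
  -- immaterial, since `R` contains the kernel of `t`.
  obtain ⟨s, hs⟩ := t.exists_rightInverse_of_surjective (LinearMap.range_eq_top.2 ht)
  have hs' : ∀ a, t (s a) = a := fun a => LinearMap.congr_fun hs a
  have hmk : ∀ x y, t x = t y → R.mkQ x = R.mkQ y := fun x y h =>
    (Submodule.Quotient.eq R).2 (hker _ (by rw [map_sub, h, sub_self]))
  have hmk0 : ∀ {x}, x ∈ R → R.mkQ x = 0 := fun hx => (Submodule.Quotient.mk_eq_zero R).2 hx
  let mul₀ : M →ₗ[ℂ] M →ₗ[ℂ] M ⧸ R := (B.mul.compl₁₂ t t).compr₂ (R.mkQ ∘ₗ s)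
  have hmul₀ : ∀ a b, mul₀ a b = R.mkQ (s (B.mul (t a) (t b))) := fun _ _ => rfl
  have hright : ∀ r ∈ R, ∀ b, mul₀ b r = 0 := fun r hr b => hmk0 (hmul r hr (t b) _ (hs' _))
  -- A one-sided ideal stable under the involution is two-sided: `r * b = (b^* * r^*)^*`.
  have hleft : ∀ r ∈ R, ∀ b, mul₀ r b = 0 := fun r hr b => by
    have h1 : s (B.star (t r)) ∈ R := hstar r hr _ (hs' _)
    have h2 : s (B.mul (B.star (t b)) (B.star (t r))) ∈ R :=
      hmul _ h1 (B.star (t b)) _ (by rw [hs', hs'])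
    rw [hmul₀]
    refine hmk0 (hstar _ h2 _ ?_)
    rw [hs', hs', ← B.star_mul, B.star_star]
  let mul₁ : M ⧸ R →ₗ[ℂ] M →ₗ[ℂ] M ⧸ R :=
    R.liftQ mul₀ fun r hr => LinearMap.mem_ker.2 (LinearMap.ext fun b => hleft r hr b)
  let mul₂ : M ⧸ R →ₗ[ℂ] M ⧸ R →ₗ[ℂ] M ⧸ R :=
    (R.liftQ mul₁.flip fun r hr => LinearMap.mem_ker.2 (LinearMap.ext fun b => by
      obtain ⟨b, rfl⟩ := R.mkQ_surjective b
      exact hright r hr b)).flip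
  have hmul₂ : ∀ a b, mul₂ (R.mkQ a) (R.mkQ b) = R.mkQ (s (B.mul (t a) (t b))) := fun _ _ => rfl
  let star₀ : M →ₛₗ[starRingEnd ℂ] M ⧸ R := (R.mkQ ∘ₗ s).comp (B.star.comp t)
  let star₁ : M ⧸ R →ₛₗ[starRingEnd ℂ] M ⧸ R :=
    R.liftQ star₀ fun r hr => LinearMap.mem_ker.2 (hmk0 (hstar r hr _ (hs' _)))
  have hstar₁ : ∀ a, star₁ (R.mkQ a) = R.mkQ (s (B.star (t a))) := fun _ => rfl
  refine ⟨⟨mul₂, star₁, fun x y z => ?_, fun x => ?_, fun x y => ?_⟩, fun a b c h => ?_,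
    fun a c h => ?_⟩
  · obtain ⟨x, rfl⟩ := R.mkQ_surjective x
    obtain ⟨y, rfl⟩ := R.mkQ_surjective y
    obtain ⟨z, rfl⟩ := R.mkQ_surjective z
    simp only [hmul₂, hs', B.mul_assoc]
  · obtain ⟨x, rfl⟩ := R.mkQ_surjective x
    rw [hstar₁, hstar₁, hs', B.star_star]
    exact hmk _ _ (hs' _)
  · obtain ⟨x, rfl⟩ := R.mkQ_surjective x
    obtain ⟨y, rfl⟩ := R.mkQ_surjective y
    simp only [hmul₂, hstar₁, hs', B.star_mul]
  · exact (hmul₂ a b).trans (hmk _ _ (by rw [hs', h]))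
  · exact (hstar₁ a).trans (hmk _ _ (by rw [hs', h]))

end Descent

/-! ### Integration along the range map -/

section PushRange

/-- The fibre integral `r_! f` along the range map of the action groupoid. -/
def pushRange (lam : ℝ) (f : Groupoid → ℂ) (y : Torus) : ℂ := ∫ t, f (y - line lam t, t)

variable (lam : ℝ)

theorem line_apply (t : ℝ) : line lam t = torusMk (t, lam * t) := rfl

theorem continuous_line : Continuous (line lam) :=
  isUnfolding_torus.continuous.comp (continuous_id.prodMk (continuous_const.mul continuous_id))

theorem continuous_range : Continuous (range lam) :=
  continuous_fst.add ((continuous_line lam).comp continuous_snd)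

theorem range_add (x y : Groupoid) : range lam (x + y) = range lam x + range lam y := by
  simp only [range, Prod.fst_add, Prod.snd_add, map_add]
  abel

theorem continuous_shear : Continuous fun z : Torus × ℝ => (z.1 - line lam z.2, z.2) :=
  (continuous_fst.sub ((continuous_line lam).comp continuous_snd)).prodMk continuous_snd

theorem contDiff_pushRange {f : Groupoid → ℂ} (hf : f ∈ densities groupoidMk univ) :
    ContDiff ℝ ∞ (pushRange lam f ∘ torusMk) := by
  let g : ℝ × ℝ → ℝ → ℂ := fun v τ => (f ∘ groupoidMk) (v + (τ, lam * τ), -τ)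
  have hg : ContDiff ℝ ∞ (fun z : (ℝ × ℝ) × ℝ => g z.1 z.2) :=
    hf.1.comp ((contDiff_fst.add (contDiff_snd.prodMk (contDiff_const.mul contDiff_snd))).prodMk
      contDiff_snd.neg)
  have hk : IsCompact (Neg.neg '' (Prod.snd '' tsupport f)) :=
    (hf.2.1.image continuous_snd).image continuous_neg
  -- The fibre integral is the convolution over `ℝ` of the constant `1` with `g v`, evaluated at
  -- `0`; this evaluation accounts for the sign of `τ` in `g`. The supports of all `g v` lie in one
  -- compact set, so smoothness in the parameter `v` follows.
  have hconv := contDiffOn_convolution_right_with_param (μ := (volume : Measure ℝ))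
    (f := fun _ : ℝ => (1 : ℂ)) (n := ⊤) (ContinuousLinearMap.mul ℝ ℂ) (g := g) isOpen_univ hk
    (fun v τ _ hτ => by
      by_contra hne
      exact hτ ⟨-τ, ⟨_, subset_tsupport _ hne, rfl⟩, neg_neg τ⟩)
    continuous_const.locallyIntegrable hg.contDiffOn
  rw [univ_prod_univ, contDiffOn_univ] at hconv
  have h0 : ContDiff ℝ ∞ fun v : ℝ × ℝ => ((v, 0) : (ℝ × ℝ) × ℝ) := contDiff_id.prodMk contDiff_const
  refine (congrArg (ContDiff ℝ ∞) (funext fun v => ?_)).mp (hconv.comp h0)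
  simp only [Function.comp_apply, pushRange, convolution_def, ContinuousLinearMap.mul_apply',
    one_mul, g]
  refine integral_congr_ae (ae_of_all _ fun t => ?_)
  have h1 : torusMk v - line lam t = torusMk (v + (0 - t, lam * (0 - t))) := by
    rw [line_apply, ← isUnfolding_torus.map_sub]
    congr 1
    ext <;> simp [sub_eq_add_neg]
  simp [groupoidMk, h1]

theorem pushRange_mem {f : Groupoid → ℂ} (hf : f ∈ densities groupoidMk univ) {S : Set Torus}
    (hS : tsupport f ⊆ range lam ⁻¹' S) : pushRange lam f ∈ densities torusMk S := by
  refine ⟨contDiff_pushRange lam hf, HasCompactSupport.of_compactSpace _, ?_⟩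
  have hc : IsClosed (range lam '' tsupport f) :=
    (hf.2.1.image (continuous_range lam)).isClosed
  refine (closure_minimal (fun y hy => ?_) hc).trans (image_subset_iff.2 hS)
  by_contra h
  refine hy (integral_eq_zero_of_ae (ae_of_all _ fun t => ?_))
  by_contra hne
  exact h ⟨_, subset_tsupport _ hne, by simp [range]⟩

theorem integrable_pushRange {f : Groupoid → ℂ} (hf : f ∈ densities groupoidMk univ) (y : Torus) :
    Integrable fun t => f (y - line lam t, t) := by
  have hc : Continuous fun t : ℝ => f (y - line lam t, t) :=
    (isUnfolding_groupoid.continuous_of_mem hf).comp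
      ((continuous_shear lam).comp (continuous_const.prodMk continuous_id))
  refine hc.integrable_of_hasCompactSupport
    (HasCompactSupport.intro (hf.2.1.image continuous_snd) fun t ht => ?_)
  by_contra hne
  exact ht ⟨_, subset_tsupport _ hne, rfl⟩

theorem isFiberIntegral_pushRange {f : Groupoid → ℂ} (hf : f ∈ densities groupoidMk univ) :
    IsFiberIntegral (range lam) f (pushRange lam f) := by
  intro u
  have hfc := isUnfolding_groupoid.continuous_of_mem hf
  have hint : Integrable (fun z : Torus × ℝ => f z * u (range lam z)) (volume.prod volume) :=
    integrable_mul_test hfc hf.2.1 (u.continuous.comp (continuous_range lam))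
  have h1 : ∫ z : Groupoid, f z * u (range lam z) =
      ∫ t : ℝ, ∫ y : Torus, f (y - line lam t, t) * u y := by
    rw [Measure.volume_eq_prod]
    refine (integral_prod_symm _ hint).trans (integral_congr_ae (ae_of_all _ fun t => ?_))
    simp only
    rw [← integral_sub_right_eq_self (fun x : Torus => f (x, t) * u (range lam (x, t)))
      (line lam t)]
    simp [range]
  rw [h1, integral_integral_swap_of_hasCompactSupport]
  · simp only [pushRange, integral_mul_const]
  · exact (hfc.comp ((continuous_shear lam).comp continuous_swap)).mul
      (u.continuous.comp continuous_snd)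
  · refine HasCompactSupport.intro (K := (fun z : Groupoid => (z.2, range lam z)) '' tsupport f)
      (hf.2.1.image (continuous_snd.prodMk (continuous_range lam))) fun z hz => ?_
    by_contra hne
    exact hz ⟨_, subset_tsupport _ (left_ne_zero_of_mul hne), by simp [range]⟩

/-- The range map is a homomorphism for the product group structure. Paired with `u`, both sides
give the double integral of `a(x) b(y) u(r(x) + r(y))`. -/
theorem pushRange_conv {a b : Groupoid → ℂ} (ha : a ∈ densities groupoidMk univ)
    (hb : b ∈ densities groupoidMk univ) :
    pushRange lam (conv a b) = conv (pushRange lam a) (pushRange lam b) := by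
  have hG := isUnfolding_groupoid
  have hT := isUnfolding_torus
  have hab := hG.conv_mem ha hb
  have hu : ∀ {f : Groupoid → ℂ}, f ∈ densities groupoidMk univ →
      pushRange lam f ∈ densities torusMk univ := fun hf =>
    pushRange_mem lam hf (subset_univ _)
  have hpb := hT.continuous_of_mem (hu hb)
  refine eq_of_forall_integral_eq (hT.continuous_of_mem (hu hab)) (hu hab).2.1
    (hT.continuous_of_mem (hT.conv_mem (hu ha) (hu hb))) (hT.conv_mem (hu ha) (hu hb)).2.1
    fun u => ?_
  rw [integral_conv_mul (hT.continuous_of_mem (hu ha)) (hu ha).2.1 hpb (hu hb).2.1,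
    ← isFiberIntegral_pushRange lam hab u]
  have h1 := integral_conv_mul (hG.continuous_of_mem ha) ha.2.1 (hG.continuous_of_mem hb) hb.2.1
    (u.comp ⟨range lam, continuous_range lam⟩)
  have h2 := isFiberIntegral_pushRange lam ha ⟨_, continuous_integral_mul_comp_add (X := Torus)
    continuous_id hpb (hu hb).2.1 u.continuous⟩
  simp only [ContinuousMap.coe_mk, id, ContinuousMap.comp_apply] at h1 h2
  rw [h1, ← h2]
  refine integral_congr_ae (ae_of_all _ fun x => ?_)
  have h3 := isFiberIntegral_pushRange lam hb (u.comp (ContinuousMap.addLeft (range lam x)))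
  simp only [ContinuousMap.comp_apply, ContinuousMap.coe_addLeft] at h3
  simp only [range_add, h3]

theorem pushRange_involution (a : Groupoid → ℂ) :
    pushRange lam (involution a) = involution (pushRange lam a) := by
  funext y
  simp only [pushRange, involution]
  rw [← integral_conj, ← integral_neg_eq_self (fun t : ℝ =>
    starRingEnd ℂ (a (-y - line lam t, t))) volume]
  refine integral_congr_ae (ae_of_all _ fun t => ?_)
  have : -((y - line lam t, t) : Groupoid) = (-y - line lam (-t), -t) := by
    ext1
    · simp
      abel
    · rfl
  simp only [this]

/-- The fibre integral along the range map, on compactly supported smooth densities. -/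
def pushRangeDens : densities groupoidMk univ →ₗ[ℂ] densities torusMk univ where
  toFun f := ⟨pushRange lam f, pushRange_mem lam f.2 (subset_univ _)⟩
  map_add' f g := Subtype.ext <| funext fun y =>
    integral_add (integrable_pushRange lam f.2 y) (integrable_pushRange lam g.2 y)
  map_smul' c _ := Subtype.ext <| funext fun _ => integral_const_mul c _

@[simp] theorem coe_pushRangeDens (f : densities groupoidMk univ) :
    (pushRangeDens lam f : Torus → ℂ) = pushRange lam f := rfl

/-- Pull `g` back along the range map and multiply by a bump in `t` of integral one. On a fibre of
the range map the pulled-back factor is constant, so integration returns `g`. -/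
theorem pushRangeDens_surjective : Function.Surjective (pushRangeDens lam) := by
  intro g
  obtain ⟨b, hb, hbc, -, hb0, hbp⟩ := isUnfolding_id.exists_bump 0 univ univ_mem
  have hbcont : Continuous b := hb.continuous
  have hpos : 0 < ∫ t, b t :=
    hbcont.integral_pos_of_hasCompactSupport_nonneg_nonzero hbc hb0 hbp.ne'
  let f : Groupoid → ℂ := fun z => ((b z.2 / ∫ t, b t : ℝ) : ℂ) * (g : Torus → ℂ) (range lam z)
  have hr : ∀ v, range lam (groupoidMk v) = torusMk (v.1 + (v.2, lam * v.2)) := fun v =>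
    (isUnfolding_torus.map_add _ _).symm
  have hsm : ContDiff ℝ ∞ (f ∘ groupoidMk) := by
    have h1 : f ∘ groupoidMk = fun v => ((b v.2 / ∫ t, b t : ℝ) : ℂ) *
        ((g : Torus → ℂ) ∘ torusMk) (v.1 + (v.2, lam * v.2)) := by
      funext v
      simp only [f, Function.comp_apply, hr]
      rfl
    rw [h1]
    refine (Complex.ofRealCLM.contDiff.comp ((hb.comp contDiff_snd).div_const _)).mul
      (g.2.1.comp (contDiff_fst.add (contDiff_snd.prodMk (contDiff_const.mul contDiff_snd))))
  have hf : f ∈ densities groupoidMk univ := by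
    refine ⟨hsm, HasCompactSupport.intro (IsCompact.prod isCompact_univ hbc) fun z hz => ?_,
      subset_univ _⟩
    have : b z.2 = 0 := image_eq_zero_of_notMem_tsupport fun h => hz ⟨mem_univ _, h⟩
    simp [f, this]
  refine ⟨⟨f, hf⟩, Subtype.ext (funext fun y => ?_)⟩
  have h2 : ∀ t, f (y - line lam t, t) =
      ((b t / ∫ t, b t : ℝ) : ℂ) * (g : Torus → ℂ) y := fun t => by
    simp [f, range]
  simp only [coe_pushRangeDens, pushRange, h2]
  rw [integral_mul_const, integral_complex_ofReal, integral_div, div_self hpos.ne']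
  simp

end PushRange

/-! ### The cover of the groupoid -/

section Boxes

variable {ι : Type} {O : ι → Set Torus} (lam : ℝ)

theorem isOpen_box (hO : ∀ i, IsOpen (O i)) (ij : ι × ι) : IsOpen (box lam O ij) :=
  ((hO _).preimage continuous_fst).inter ((hO _).preimage (continuous_range lam))

theorem iUnion_box (hcover : ⋃ i, O i = univ) : ⋃ ij, box lam O ij = univ := by
  refine eq_univ_of_forall fun x => ?_
  obtain ⟨i, hi⟩ := mem_iUnion.1 (hcover ▸ mem_univ (source x))
  obtain ⟨j, hj⟩ := mem_iUnion.1 (hcover ▸ mem_univ (range lam x))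
  exact mem_iUnion.2 ⟨(i, j), hi, hj⟩

end Boxes

end IrrationalTorus

end

/-! ### The main theorem -/

open IrrationalTorus

theorem mainTheorem3 (lam : ℝ) (hlam : Irrational lam) {ι : Type} [DecidableEq ι]
    (O : ι → Set IrrationalTorus.Torus) (hO : ∀ i, IsOpen (O i)) (hcover : ⋃ i, O i = Set.univ) :
    ∃ (S : IrrationalTorus.StarAlg (IrrationalTorus.CcG lam O))
      (T : IrrationalTorus.StarAlg (IrrationalTorus.CcGroupoid lam O))
      (Φ : IrrationalTorus.CcGroupoid lam O →ₗ[ℂ] IrrationalTorus.CcG lam O),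
      -- the two structures and the map are the prescribed ones, which are well defined
      (IrrationalTorus.IsTorusStructure lam O S ∧
        ∀ S', IrrationalTorus.IsTorusStructure lam O S' → S' = S) ∧
      (IrrationalTorus.IsProductGroupStructure lam O T ∧
        ∀ T', IrrationalTorus.IsProductGroupStructure lam O T' → T' = T) ∧
      (IrrationalTorus.IsPhi lam O Φ ∧ ∀ Φ', IrrationalTorus.IsPhi lam O Φ' → Φ' = Φ) ∧
      -- `Φ` is a surjective `*`-homomorphism
      Function.Surjective Φ ∧
      (∀ x, Φ (T.star x) = S.star (Φ x)) ∧
      ∀ x y, Φ (T.mul x y) = S.mul (Φ x) (Φ y) := by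
  have hT := isUnfolding_torus
  have hG := isUnfolding_groupoid
  have hB := isOpen_box lam hO
  have hBcover := iUnion_box lam hcover
  have tT : Function.Surjective (totalDens torusMk O) := fun f =>
    (hT.exists_total_eq hO hcover f.2).imp fun _ h => Subtype.ext h
  have tG : Function.Surjective (totalDens groupoidMk (box lam O)) := fun f =>
    (hG.exists_total_eq hB hBcover f.2).imp fun _ h => Subtype.ext h
  have kT : ∀ x, totalDens torusMk O x = 0 →
      x ∈ relations torusMk (proj lam) (fun _ V χ => IsPlot lam V χ) O := fun x hx =>
    mem_torus_relations_of_total_eq_zero lam hO (congrArg Subtype.val hx)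
  have kG : ∀ x, totalDens groupoidMk (box lam O) x = 0 →
      x ∈ relations groupoidMk (id : Groupoid → Groupoid) (fun _ V φ => IsBisubmersion V φ)
        (box lam O) := fun x hx =>
    mem_groupoid_relations_of_total_eq_zero hB (congrArg Subtype.val hx)
  have zG : ∀ x ∈ relations groupoidMk (id : Groupoid → Groupoid)
      (fun _ V φ => IsBisubmersion V φ) (box lam O), totalDens groupoidMk (box lam O) x = 0 :=
    fun x hx => Subtype.ext (total_eq_zero_of_mem_groupoid_relations hx)
  obtain ⟨S, hSmul, hSstar⟩ := hT.starAlg.exists_descent (totalDens torusMk O) tT _ kT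
    (fun r hr x hx => mem_torus_relations_of_total_eq_involution lam hO hcover hr
      (congrArg Subtype.val hx))
    (fun r hr b x hx => mem_torus_relations_of_total_eq_conv lam hO hcover b.2 hr
      (congrArg Subtype.val hx))
  -- Stability is automatic here: a groupoid relation has total zero, hence so do its involution and
  -- its products.
  obtain ⟨T, hTmul, hTstar⟩ := hG.starAlg.exists_descent (totalDens groupoidMk (box lam O)) tG _ kG
    (fun r hr x hx => kG x (by rw [hx, zG r hr, map_zero]))
    (fun r hr b x hx => kG x (by rw [hx, zG r hr, map_zero]))
  obtain ⟨s, hs⟩ := (totalDens torusMk O).exists_rightInverse_of_surjective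
    (LinearMap.range_eq_top.2 tT)
  have hs' : ∀ a, totalDens torusMk O (s a) = a := fun a => LinearMap.congr_fun hs a
  have hmk : ∀ x y, totalDens torusMk O x = totalDens torusMk O y →
      mkG lam O x = mkG lam O y := fun x y h =>
    (Submodule.Quotient.eq _).2 (kT _ (by rw [map_sub, h, sub_self]))
  let Φ : CcGroupoid lam O →ₗ[ℂ] CcG lam O := Submodule.liftQ _
    (mkG lam O ∘ₗ s ∘ₗ pushRangeDens lam ∘ₗ totalDens groupoidMk (box lam O))
    fun r hr => by
      simp only [LinearMap.mem_ker, LinearMap.comp_apply, zG r hr, map_zero]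
  have hΦ : ∀ x y, totalDens torusMk O y = pushRangeDens lam (totalDens groupoidMk (box lam O) x) →
      Φ (mkGroupoid lam O x) = mkG lam O y := fun x y h => hmk _ _ ((hs' _).trans h.symm)
  have hΦs : ∀ x, Φ (mkGroupoid lam O x) =
      mkG lam O (s (pushRangeDens lam (totalDens groupoidMk (box lam O) x))) := fun x =>
    hΦ x _ (hs' _)
  have surjT : Function.Surjective (mkG lam O) := Submodule.mkQ_surjective _
  have surjG : Function.Surjective (mkGroupoid lam O) := Submodule.mkQ_surjective _
  have pushT : ∀ (ij : ι × ι) (f : Dens groupoidMk (box lam O ij)),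
      pushRange lam f.coeff ∈ densities torusMk (O ij.2) := fun ij f =>
    pushRange_mem lam (densities_mono (subset_univ _) f.coeff_mem) fun x hx =>
      (f.coeff_mem.2.2 hx).2
  have fibT : ∀ (ij : ι × ι) (f : Dens groupoidMk (box lam O ij)),
      IsFiberIntegral (range lam) f.coeff (pushRange lam f.coeff) := fun ij f =>
    isFiberIntegral_pushRange lam (densities_mono (subset_univ _) f.coeff_mem)
  refine ⟨S, T, Φ, ⟨⟨fun a b c h => ?_, fun a c h => ?_⟩, fun S' hS' => ?_⟩,
    ⟨⟨fun a b c h => ?_, fun a c h => ?_⟩, fun T' hT' => ?_⟩, ⟨fun ij f g h => ?_, fun Φ' hΦ' => ?_⟩,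
    fun x => ?_, fun x => ?_, fun x y => ?_⟩
  · exact hSmul a b c (Subtype.ext
      ((hT.isConvolution_iff_eq (total_mem a) (total_mem b) (total_mem c)).1 h))
  · exact hSstar a c (Subtype.ext h)
  · refine StarAlg.ext (LinearMap.ext fun x => LinearMap.ext fun y => ?_)
      (LinearMap.ext fun x => ?_)
    · obtain ⟨a, rfl⟩ := surjT x
      obtain ⟨b, rfl⟩ := surjT y
      -- Every convolution is the total of some `c`, so the prescribed formula determines the
      -- product of any two classes.
      obtain ⟨c, hc⟩ := tT (hT.starAlg.mul (totalDens torusMk O a) (totalDens torusMk O b))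
      rw [hS'.1 a b c ((hT.isConvolution_iff_eq (total_mem a) (total_mem b) (total_mem c)).2
        (congrArg Subtype.val hc))]
      exact (hSmul a b c hc).symm
    · obtain ⟨a, rfl⟩ := surjT x
      obtain ⟨c, hc⟩ := tT (hT.starAlg.star (totalDens torusMk O a))
      rw [hS'.2 a c (congrArg Subtype.val hc)]
      exact (hSstar a c hc).symm
  · exact hTmul a b c (Subtype.ext
      ((hG.isConvolution_iff_eq (total_mem a) (total_mem b) (total_mem c)).1 h))
  · exact hTstar a c (Subtype.ext h)
  · refine StarAlg.ext (LinearMap.ext fun x => LinearMap.ext fun y => ?_)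
      (LinearMap.ext fun x => ?_)
    · obtain ⟨a, rfl⟩ := surjG x
      obtain ⟨b, rfl⟩ := surjG y
      obtain ⟨c, hc⟩ := tG (hG.starAlg.mul (totalDens groupoidMk (box lam O) a)
        (totalDens groupoidMk (box lam O) b))
      rw [hT'.1 a b c ((hG.isConvolution_iff_eq (total_mem a) (total_mem b) (total_mem c)).2
        (congrArg Subtype.val hc))]
      exact (hTmul a b c hc).symm
    · obtain ⟨a, rfl⟩ := surjG x
      obtain ⟨c, hc⟩ := tG (hG.starAlg.star (totalDens groupoidMk (box lam O) a))
      rw [hT'.2 a c (congrArg Subtype.val hc)]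
      exact (hTstar a c hc).symm
  · refine hΦ _ _ (Subtype.ext ?_)
    -- Fibre integrals that are continuous with compact support are unique, so any admissible `g` is
    -- the explicit one.
    have hg : g.coeff = pushRange lam f.coeff :=
      h.eq (fibT ij f) (hT.continuous_of_mem g.coeff_mem) g.coeff_mem.2.1
        (hT.continuous_of_mem (pushT ij f)) (pushT ij f).2.1
    simp only [coe_totalDens, coe_pushRangeDens, total_lof]
    exact hg
  · refine LinearMap.ext fun x => ?_
    obtain ⟨x, rfl⟩ := surjG x
    induction x using DirectSum.induction_on with
    | zero => simp only [map_zero]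
    | of ij f =>
      refine (hΦ' ij f (Dens.mk _ (pushT ij f)) (fibT ij f)).trans (hΦ _ _ (Subtype.ext ?_)).symm
      rw [coe_totalDens, coe_pushRangeDens, coe_totalDens, total_lof]
      exact congrArg (pushRange lam) (total_lof ij f).symm
    | add x y hx hy => simp only [map_add, hx, hy]
  · obtain ⟨y, rfl⟩ := surjT x
    obtain ⟨f, hf⟩ := pushRangeDens_surjective lam (totalDens torusMk O y)
    obtain ⟨x, hx⟩ := tG f
    exact ⟨mkGroupoid lam O x, hΦ x y (by rw [hx, hf])⟩
  · obtain ⟨a, rfl⟩ := surjG x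
    obtain ⟨c, hc⟩ := tG (hG.starAlg.star (totalDens groupoidMk (box lam O) a))
    rw [show T.star (mkGroupoid lam O a) = mkGroupoid lam O c from hTstar a c hc, hΦs a]
    refine ((hSstar _ (s (pushRangeDens lam (totalDens groupoidMk (box lam O) c))) ?_).trans
      (hΦs c).symm).symm
    rw [hs', hs', hc]
    exact Subtype.ext (pushRange_involution lam _)
  · obtain ⟨a, rfl⟩ := surjG x
    obtain ⟨b, rfl⟩ := surjG y
    obtain ⟨c, hc⟩ := tG (hG.starAlg.mul (totalDens groupoidMk (box lam O) a)
      (totalDens groupoidMk (box lam O) b))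
    rw [show T.mul (mkGroupoid lam O a) (mkGroupoid lam O b) = mkGroupoid lam O c from
      hTmul a b c hc, hΦs a, hΦs b]
    refine ((hSmul _ _ (s (pushRangeDens lam (totalDens groupoidMk (box lam O) c))) ?_).trans
      (hΦs c).symm).symm
    rw [hs', hs', hs', hc]
    exact Subtype.ext (pushRange_conv lam (Subtype.prop _) (Subtype.prop _))
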